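/- Let $n\ge 1$ and let $X$ be a finite simplicial complex that is pure of dimension $n$ (it has an $n$-simplex, and every simplex is a face of an $n$-simplex). Write $X^{(k)}$ for the set of its $k$-simplices, $X^{(-1)}=\{\emptyset\}$. Let $m$ be a weight function on $X$: $m>0$ on $\bigcup_{k=-1}^{n}X^{(k)}$ and $m(\tau)=\sum_{\sigma\in X^{(k+1)},\,\tau\subset\sigma}m(\sigma)$ for all $\tau\in X^{(k)}$, $-1\le k\le n-1$; for example the homogeneous weight $m(\tau)=(n-k)!\,|\{\sigma\in X^{(n)}:\tau\subseteq\sigma\}|$ for $\tau\in X^{(k)}$. The link $X_\tau$ of $\tau\in X^{(k)}$ consists of the simplices $\sigma$ disjoint from $\tau$ with $\tau\cup\sigma$ a simplex of $X$; it carries the weight $m_\tau(\sigma)=m(\tau\cup\sigma)$, and $X_\emptyset=X$. Its upper Laplacian on functions on its vertices is $$\Delta^+_{\tau,0}\phi(u)=\sum_{v:\{u,v\}\in X_\tau^{(1)}}\frac{m_\tau(\{u,v\})}{m_\tau(\{u\})}\,(\phi(u)-\phi(v)).$$ Let $\kappa\ge\lambda>\frac{n-1}{n}$. Say that $(X,m)$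 has two-sided $(\lambda,\kappa)$-local spectral expansion if $X_\tau$ is connected for every $\tau\in X^{(k)}$, $-1\le k\le n-2$, and $\mathrm{Spec}(\Delta^+_{\tau,0})\setminus\{0\}\subseteq[\lambda,\kappa]$ for every $\tau\in X^{(n-2)}$. Let $f(x)=2-\frac1x$, let $f^{i}$ be its $i$-fold iterate, and let $1\le l\le n$. For $0\le j\le l-1$ put $\lambda_j=f^{n-1-j}(\lambda)$, $\kappa_j=f^{n-1-j}(\kappa)$, $r_j=\frac{\lambda_j+\kappa_j}{2}$, $\varepsilon_j=(l-j)(j+1)\left(\frac{(j+1)\kappa_j-j}{2}\right)^{l-j-1}\frac{\kappa_j-\lambda_j}{2}$, and $$\mathcal A_l(\lambda,\kappa)=\prod_{j=0}^{l-1}r_j^{\,l-j},\qquad \mathcal E_l(\lambda,\kappa)=\sum_{i=0}^{l-1}\varepsilon_i\prod_{j=i+1}^{l-1}r_j^{\,l-j}.$$ **Theorem.** For all $1\le l\le n$, the functions $\mathcal A_l$ and $\mathcal E_l$ are continuous on $(\frac{n-1}{n},\infty)^2$, and $\mathcal A_l(\lambda,\kappa)\to1$, $\mathcal E_l(\lambda,\kappa)\to0$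 as $(\lambda,\kappa)\to(1,1)$. Moreover, let $(X,m)$ be as above with two-sided $(\lambda,\kappa)$-local spectral expansion, let $U_0,\dots,U_l\subseteq X^{(0)}$ be pairwise disjoint and nonempty, and write $$m(U)=\sum_{u\in U}m(\{u\}),\qquad m(U_0,\dots,U_l)=\sum_{\{u_0,\dots,u_l\}\in X^{(l)},\ u_0\in U_0,\dots,u_l\in U_l}m(\{u_0,\dots,u_l\}).$$ Then $$\left|m(U_0,\dots,U_l)-\mathcal A_l(\lambda,\kappa)\frac{m(U_0)\cdots m(U_l)}{m(X^{(0)})^l}\right|\le\mathcal E_l(\lambda,\kappa)\min_{0\le i<j\le l}\sqrt{m(U_i)m(U_j)}$$ and $$\left|m(U_0,\dots,U_l)-\mathcal A_l(\lambda,\kappa)\frac{m(U_0)\cdots m(U_l)}{m(X^{(0)})^l}\right|\le\mathcal E_l(\lambda,\kappa)\bigl(m(U_0)\cdots m(U_l)\bigr)^{\frac1{l+1}}.$$ -/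

import Mathlib

open Filter Topology

namespace LocalSpectral

variable {V : Type*} [Fintype V] [DecidableEq V]

section Complexes

open scoped Classical in
/-- The simplices of `X` with `c` vertices, that is, the simplices of dimension `c - 1`.
The empty set counts as the unique simplex of dimension `-1`. -/
noncomputable def cells (X : PreAbstractSimplicialComplex V) (c : ℕ) : Finset (Finset V) :=
  Finset.univ.filter fun s => s.card = c ∧ (s = ∅ ∨ s ∈ X)

open scoped Classical in
/-- The vertex set of `X`. -/
noncomputable def verts (X : PreAbstractSimplicialComplex V) : Finset V :=
  Finset.univ.filter fun v => {v} ∈ X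

/-- `X` is pure of dimension `n`: it has a simplex of dimension `n`, and every simplex is a face
of a simplex of dimension `n`. -/
def IsPure (X : PreAbstractSimplicialComplex V) (n : ℕ) : Prop :=
  (∃ t ∈ X, t.card = n + 1) ∧ ∀ s ∈ X, ∃ t ∈ X, s ⊆ t ∧ t.card = n + 1

/-- The graph on the vertices of `X` whose edges are the one-dimensional simplices of `X`. -/
def skeletonGraph (X : PreAbstractSimplicialComplex V) : SimpleGraph {v : V // v ∈ verts X} where
  Adj u v := u ≠ v ∧ ({u.1, v.1} : Finset V) ∈ X
  symm := ⟨fun u v h => ⟨h.1.symm, by rw [Finset.pair_comm]; exact h.2⟩⟩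
  loopless := ⟨fun _ h => h.1 rfl⟩

/-- The link of `τ` in `X`. -/
def link (X : PreAbstractSimplicialComplex V) (τ : Finset V) : PreAbstractSimplicialComplex V where
  faces := {s | s.Nonempty ∧ Disjoint τ s ∧ τ ∪ s ∈ X}
  isRelLowerSet_faces := by
    rintro s ⟨hs, hd, hX⟩
    refine ⟨hs, fun t hts ht => ⟨ht, hd.mono_right hts, ?_⟩⟩
    exact (X.isRelLowerSet_faces hX).2 (Finset.union_subset_union_right hts)
      (ht.mono Finset.subset_union_right)

/-- `m` is a weight function on the `n`-dimensional complex `X`: it is positive on all simplices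
(the empty one included), and the weight of every simplex of dimension less than `n` is the sum of
the weights of the simplices of one dimension more that contain it. The values of `m` on sets that
are not simplices play no role. -/
def IsWeight (X : PreAbstractSimplicialComplex V) (n : ℕ) (m : Finset V → ℝ) : Prop :=
  (∀ c ≤ n + 1, ∀ τ ∈ cells X c, 0 < m τ) ∧
  ∀ c ≤ n, ∀ τ ∈ cells X c, ∑ σ ∈ (cells X (c + 1)).filter (fun σ => τ ⊆ σ), m σ = m τ

/-- The homogeneous weight function of an `n`-dimensional complex: `(n - k)!` times the number of
`n`-dimensional simplices that contain `τ`, where `k = τ.card - 1` is the dimension of `τ`. -/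
noncomputable def homogeneousWeight (X : PreAbstractSimplicialComplex V) (n : ℕ)
    (τ : Finset V) : ℝ :=
  (n + 1 - τ.card).factorial * ((cells X (n + 1)).filter fun σ => τ ⊆ σ).card

/-- The weight function which `m` induces on the link of `τ`. -/
def linkWeight (m : Finset V → ℝ) (τ : Finset V) : Finset V → ℝ := fun σ => m (τ ∪ σ)

end Complexes

section Laplacian

open scoped Classical in
/-- The upper Laplacian `Δ₀⁺ = δ₀ d₀` of the weighted complex `(X, m)` on the space of `0`-forms,
where `(d₀ φ)(v, u) = φ u - φ v` and `(δ₀ ψ)(u) = ∑ v, (m {v, u} / m {u}) ψ (v, u)`, the sum running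
over the neighbours `v` of `u`. -/
noncomputable def upLaplacian (X : PreAbstractSimplicialComplex V) (m : Finset V → ℝ) :
    Module.End ℝ ({v : V // v ∈ verts X} → ℝ) where
  toFun φ u := ∑ v with (skeletonGraph X).Adj v u, m {v.1, u.1} / m {u.1} * (φ u - φ v)
  map_add' φ ψ := by
    funext u
    simp only [Pi.add_apply, ← Finset.sum_add_distrib]
    exact Finset.sum_congr rfl fun v _ => by ring
  map_smul' a φ := by
    funext u
    simp only [Pi.smul_apply, smul_eq_mul, RingHom.id_apply, Finset.mul_sum]
    exact Finset.sum_congr rfl fun v _ => by ring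

open scoped Classical in
/-- `⟨Δ₀⁺ φ, ψ⟩ = ⟨d₀ φ, d₀ ψ⟩` for the inner products
`⟨φ, ψ⟩ = ∑ τ, m τ / (k + 1)! * φ τ * ψ τ` (sum over ordered `k`-simplices) of `k`-forms. -/
theorem inner_upLaplacian (X : PreAbstractSimplicialComplex V) (m : Finset V → ℝ)
    (hm : ∀ u ∈ verts X, m {u} ≠ 0) (φ ψ : {v : V // v ∈ verts X} → ℝ) :
    ∑ u, m {u.1} * upLaplacian X m φ u * ψ u =
      ∑ u, ∑ v with (skeletonGraph X).Adj v u,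
        m {v.1, u.1} / 2 * (φ u - φ v) * (ψ u - ψ v) := by
  have h1 : ∑ u, m {u.1} * upLaplacian X m φ u * ψ u =
      ∑ u, ∑ v with (skeletonGraph X).Adj v u, m {v.1, u.1} * (φ u - φ v) * ψ u := by
    refine Finset.sum_congr rfl fun u _ => ?_
    have hu := hm u.1 u.2
    simp only [upLaplacian, LinearMap.coe_mk, AddHom.coe_mk, Finset.mul_sum, Finset.sum_mul]
    exact Finset.sum_congr rfl fun v _ => by field_simp
  have h2 : ∑ u, ∑ v with (skeletonGraph X).Adj v u, m {v.1, u.1} * (φ u - φ v) * ψ u =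
      ∑ u, ∑ v with (skeletonGraph X).Adj v u, m {v.1, u.1} * (φ v - φ u) * ψ v := by
    simp only [Finset.sum_filter]
    rw [Finset.sum_comm]
    refine Finset.sum_congr rfl fun u _ => Finset.sum_congr rfl fun v _ => ?_
    rw [(skeletonGraph X).adj_comm, Finset.pair_comm]
  have h3 : ∑ u, ∑ v with (skeletonGraph X).Adj v u,
        m {v.1, u.1} / 2 * (φ u - φ v) * (ψ u - ψ v) =
      (∑ u, ∑ v with (skeletonGraph X).Adj v u, m {v.1, u.1} * (φ u - φ v) * ψ u) / 2 +
      (∑ u, ∑ v with (skeletonGraph X).Adj v u, m {v.1, u.1} * (φ v - φ u) * ψ v) / 2 := by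
    simp only [Finset.sum_div, ← Finset.sum_add_distrib]
    exact Finset.sum_congr rfl fun u _ => Finset.sum_congr rfl fun v _ => by ring
  rw [h1, h3, ← h2]
  ring

end Laplacian

/-- Two-sided `(lam, kap)`-local spectral expansion of an `n`-dimensional weighted complex
`(X, m)`. The empty simplex is allowed as `τ`; its link is `X` itself. -/
structure TwoSidedLocalSpectralExpansion (X : PreAbstractSimplicialComplex V) (m : Finset V → ℝ)
    (n : ℕ) (lam kap : ℝ) : Prop where
  lower : ((n : ℝ) - 1) / n < lam
  le : lam ≤ kap
  /-- `X` and all its links of positive dimension are connected. -/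
  connected : ∀ c, c + 1 ≤ n → ∀ τ ∈ cells X c, (skeletonGraph (link X τ)).Connected
  /-- The nonzero spectrum of every one-dimensional link lies in `[lam, kap]`. -/
  spectrum_subset : ∀ c, c + 1 = n → ∀ τ ∈ cells X c,
    spectrum ℝ (upLaplacian (link X τ) (linkWeight m τ)) \ {0} ⊆ Set.Icc lam kap

section MixedWeights

/-- The weight of a set of vertices. -/
def vertexWeight (m : Finset V → ℝ) (U : Finset V) : ℝ := ∑ u ∈ U, m {u}

open scoped Classical in
/-- `m(U₀, …, U_l)`: the sum of the weights of the `l`-dimensional simplices `{u₀, …, u_l}` with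
`u₀ ∈ U₀, …, u_l ∈ U_l`. -/
noncomputable def mixedWeight (X : PreAbstractSimplicialComplex V) (m : Finset V → ℝ) {l : ℕ}
    (U : Fin (l + 1) → Finset V) : ℝ :=
  ∑ s ∈ (cells X (l + 1)).filter
    (fun s => ∃ u : Fin (l + 1) → V, (∀ i, u i ∈ U i) ∧ s = Finset.univ.image u), m s

end MixedWeights

section Constants

/-- `f x = 2 - 1 / x`. -/
noncomputable def descend (x : ℝ) : ℝ := 2 - 1 / x

/-- The bound `x` on the spectra of the one-dimensional links, descended to the links of the
simplices of dimension `j - 1`: the `(n - 1 - j)`-fold iterate of `f`. -/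
noncomputable def level (n j : ℕ) (x : ℝ) : ℝ := descend^[n - 1 - j] x

/-- `r_j = (λ_j + κ_j) / 2`. -/
noncomputable def rCoef (n j : ℕ) (p : ℝ × ℝ) : ℝ := (level n j p.1 + level n j p.2) / 2

/-- `ε_j = (l - j) (j + 1) (((j + 1) κ_j - j) / 2) ^ (l - j - 1) (κ_j - λ_j) / 2`, for `j < l`. -/
noncomputable def epsCoef (n l j : ℕ) (p : ℝ × ℝ) : ℝ :=
  ((l : ℝ) - j) * ((j : ℝ) + 1) * ((((j : ℝ) + 1) * level n j p.2 - j) / 2) ^ (l - j - 1) *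
    ((level n j p.2 - level n j p.1) / 2)

/-- `𝒜_l (λ, κ) = ∏_{j < l} r_j ^ (l - j)`. -/
noncomputable def mainCoef (n l : ℕ) (p : ℝ × ℝ) : ℝ :=
  ∏ j ∈ Finset.range l, rCoef n j p ^ (l - j)

/-- `ℰ_l (λ, κ) = ∑_{i < l} ε_i ∏_{i < j < l} r_j ^ (l - j)`. -/
noncomputable def errorCoef (n l : ℕ) (p : ℝ × ℝ) : ℝ :=
  ∑ i ∈ Finset.range l, epsCoef n l i p * ∏ j ∈ Finset.Ioo i l, rCoef n j p ^ (l - j)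

/-- The pairs `(λ, κ)` with both entries larger than `(n - 1) / n`. -/
def paramDomain (n : ℕ) : Set (ℝ × ℝ) := Set.Ioi (((n : ℝ) - 1) / n) ×ˢ Set.Ioi (((n : ℝ) - 1) / n)

end Constants

section Homogeneous

/-- The homogeneous weight function is a weight function. -/
theorem isWeight_homogeneousWeight (X : PreAbstractSimplicialComplex V) (n : ℕ)
    (hX : IsPure X n) : IsWeight X n (homogeneousWeight X n) := by
  classical
  have hc : ∀ c s, s ∈ cells X c ↔ s.card = c ∧ (s = ∅ ∨ s ∈ X) := fun c s => by simp [cells]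
  refine ⟨fun c _ τ hτ => ?_, fun c hcn τ hτ => ?_⟩
  · have : ((cells X (n + 1)).filter fun σ => τ ⊆ σ).Nonempty := by
      rcases ((hc c τ).1 hτ).2 with rfl | h
      · obtain ⟨t, ht, htc⟩ := hX.1
        exact ⟨t, by simp [hc, ht, htc]⟩
      · obtain ⟨t, ht, hst, htc⟩ := hX.2 τ h
        exact ⟨t, by simp [hc, ht, htc, hst]⟩
    have := this.card_pos
    unfold homogeneousWeight
    positivity
  · have hτc := ((hc c τ).1 hτ).1
    unfold homogeneousWeight
    have h1 : ∀ σ ∈ (cells X (c + 1)).filter (fun σ => τ ⊆ σ),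
        ((n + 1 - σ.card).factorial : ℝ) * ((cells X (n + 1)).filter fun η => σ ⊆ η).card =
        (n - c).factorial * ((cells X (n + 1)).filter fun η => σ ⊆ η).card := by
      intro σ hσ
      rw [((hc _ _).1 (Finset.mem_filter.1 hσ).1).1]
      congr 3
      omega
    rw [Finset.sum_congr rfl h1, ← Finset.mul_sum, ← Nat.cast_sum]
    have h2 : ∑ σ ∈ (cells X (c + 1)).filter (fun σ => τ ⊆ σ),
        ((cells X (n + 1)).filter fun η => σ ⊆ η).card =
        (n + 1 - c) * ((cells X (n + 1)).filter fun η => τ ⊆ η).card := by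
      have h3 := Finset.sum_card_bipartiteAbove_eq_sum_card_bipartiteBelow
        (s := (cells X (c + 1)).filter (fun σ => τ ⊆ σ))
        (t := (cells X (n + 1)).filter (fun η => τ ⊆ η)) (fun σ η => σ ⊆ η)
      have h4 : ∀ σ ∈ (cells X (c + 1)).filter (fun σ => τ ⊆ σ),
          (Finset.bipartiteAbove (fun σ η => σ ⊆ η)
            ((cells X (n + 1)).filter (fun η => τ ⊆ η)) σ).card =
          ((cells X (n + 1)).filter fun η => σ ⊆ η).card := by
        intro σ hσ
        congr 1
        ext η
        simp only [Finset.mem_bipartiteAbove, Finset.mem_filter]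
        exact ⟨fun h => ⟨h.1.1, h.2⟩,
          fun h => ⟨⟨h.1, (Finset.mem_filter.1 hσ).2.trans h.2⟩, h.2⟩⟩
      rw [Finset.sum_congr rfl h4] at h3
      rw [h3, mul_comm, ← smul_eq_mul]
      refine Finset.sum_const_nat fun η hη => ?_
      obtain ⟨hη, hτη⟩ := Finset.mem_filter.1 hη
      obtain ⟨hηc, hηX⟩ := (hc _ _).1 hη
      have hηX : η ∈ X := hηX.resolve_left (by rintro rfl; simp at hηc)
      have h5 : Finset.bipartiteBelow (fun σ η => σ ⊆ η)
          ((cells X (c + 1)).filter (fun σ => τ ⊆ σ)) η =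
          (η \ τ).image (fun v => insert v τ) := by
        ext σ
        simp only [Finset.mem_bipartiteBelow, Finset.mem_filter, Finset.mem_image,
          Finset.mem_sdiff, hc]
        constructor
        · rintro ⟨⟨⟨hσc, -⟩, hτσ⟩, hση⟩
          have : (σ \ τ).card = 1 := by
            rw [Finset.card_sdiff_of_subset hτσ]; omega
          obtain ⟨v, hv⟩ := Finset.card_eq_one.1 this
          have hv' : v ∈ σ \ τ := by rw [hv]; simp
          rw [Finset.mem_sdiff] at hv'
          refine ⟨v, ⟨hση hv'.1, hv'.2⟩, ?_⟩
          rw [Finset.insert_eq, ← hv, Finset.sdiff_union_of_subset hτσ]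
        · rintro ⟨v, ⟨hvη, hvτ⟩, rfl⟩
          have hsub : insert v τ ⊆ η := Finset.insert_subset hvη hτη
          exact ⟨⟨⟨by rw [Finset.card_insert_of_notMem hvτ, hτc], Or.inr
            ((X.isRelLowerSet_faces hηX).2 hsub (Finset.insert_nonempty v τ))⟩,
            Finset.subset_insert v τ⟩, hsub⟩
      rw [h5, Finset.card_image_of_injOn, Finset.card_sdiff_of_subset hτη, hηc, hτc]
      intro v hv w hw hvw
      have hv := (Finset.mem_sdiff.1 (Finset.mem_coe.1 hv)).2
      have : v ∈ insert w τ := by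
        have h : v ∈ insert v τ := Finset.mem_insert_self v τ
        rwa [show insert v τ = insert w τ from hvw] at h
      exact (Finset.mem_insert.1 this).resolve_right hv
    rw [h2, hτc]
    have : n + 1 - c = (n - c) + 1 := by omega
    rw [this, Nat.factorial_succ]
    push_cast
    ring

end Homogeneous

end LocalSpectral

namespace LocalSpectral

/-! ### The iterates of `descend` and the constants built from them. -/

section Constants

/-! The number m(U_0, ..., U_l) and the product m(U_0)⋯m(U_l) / m(∅)^l are the two ends of a chain
of walk weights W_0, ..., W_l. In W_j (`walkWeight`) the positions are lists of j vertices. A step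
adds a vertex of the next colour at the end and drops the first vertex. For j = 0 the steps are
independent, which gives the product. For j = l a single step crosses all l + 1 colours, which gives
the mixed weight. It remains to compare W_{j+1} with r_j^{l-j} W_j and to telescope
(`abs_sub_prod_mul_le`).

Both W_j and W_{j+1} can be read on lists of length j + 1, where a step goes from u :: y to y ++
[v]. With y fixed it is an operator on the weighted link of y: the adjacency operator 1 - Δ for
W_{j+1}, and the projection P to the constants for W_j. If the nonzero spectrum of Δ lies in [λ_j,
κ_j], then 1 - Δ - r_j P has spectrum in [1 - κ_j, 1 - λ_j]. Since u and v have different colours,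
only an off-diagonal block matters, and its norm is at most half the width of the spectrum
(`sum_sq_le_of_form_bounds`). So the difference of the two steps costs (κ_j - λ_j) / 2, while each
remaining step costs at most κ_j / 2. Replacing the l - j steps one at a time
(`listNorm_pathSum_sub_le`) and applying Cauchy–Schwarz gives the error with the factor √(m(U_0)
m(U_l)) (`abs_walkWeight_sub_le`).

The spectral bounds for all links come from those for the one-dimensional links by Garland's
localization (`descend_eigenvalue`, `linkBounds_level`): the energy of an eigenfunction on the link
of τ is the sum of its energies on the links of τ ∪ {u}, and the eigenvalue equation gives its means
there.

The mixed weight is symmetric in the colours, so any two of them may be placed first and last.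
Multiplying the bounds for cyclically adjacent pairs yields the geometric mean. -/

/-- The map f sends (a + 1) / (a + 2) to a / (a + 1) and increases on the positive reals. Each
iterate thus moves the threshold down one place and stays away from the pole at 0. -/
theorem lt_descend {a x : ℝ} (ha : 0 ≤ a) (hx : (a + 1) / (a + 2) < x) :
    a / (a + 1) < descend x := by
  have h1 : 0 < (a + 1) / (a + 2) := by positivity
  have h2 : 1 / x < (a + 2) / (a + 1) := by
    have := one_div_lt_one_div_of_lt h1 hx
    rwa [one_div_div] at this
  have h3 : a / (a + 1) = 2 - (a + 2) / (a + 1) := by field_simp; ring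
  unfold descend
  linarith

theorem descend_le_descend {x y : ℝ} (hx : 0 < x) (hxy : x ≤ y) : descend x ≤ descend y := by
  have := one_div_le_one_div_of_le hx hxy
  unfold descend
  linarith

theorem lt_iterate_descend (i : ℕ) {a x : ℝ} (ha : 0 ≤ a) (hx : (a + i) / (a + i + 1) < x) :
    a / (a + 1) < descend^[i] x := by
  induction i generalizing x with
  | zero => simpa using hx
  | succ i ih =>
    rw [Function.iterate_succ_apply]
    refine ih (lt_descend (by positivity) ?_)
    push_cast at hx
    convert hx using 2 <;> ring

theorem iterate_descend_le (i : ℕ) {x y : ℝ} (hx : (i : ℝ) / (i + 1) < x) (hxy : x ≤ y) :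
    descend^[i] x ≤ descend^[i] y := by
  induction i generalizing x y with
  | zero => simpa using hxy
  | succ i ih =>
    rw [Function.iterate_succ_apply, Function.iterate_succ_apply]
    push_cast at hx
    refine ih (lt_descend (by positivity) ?_) (descend_le_descend ?_ hxy)
    · convert hx using 2; ring
    · exact lt_trans (by positivity) hx

theorem continuousOn_iterate_descend (i : ℕ) :
    ContinuousOn descend^[i] (Set.Ioi ((i : ℝ) / (i + 1))) := by
  induction i with
  | zero => exact continuousOn_id
  | succ i ih =>
    rw [Function.iterate_succ]
    refine ih.comp ?_ ?_
    · unfold descend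
      refine continuousOn_const.sub (continuousOn_const.div continuousOn_id fun x hx => ?_)
      exact (lt_trans (by positivity : (0 : ℝ) < ((i + 1 : ℕ) : ℝ) / ((i + 1 : ℕ) + 1)) hx).ne'
    · intro x hx
      refine lt_descend (by positivity) ?_
      have hx : (((i + 1 : ℕ) : ℝ)) / ((i + 1 : ℕ) + 1) < x := hx
      push_cast at hx
      convert hx using 2; ring

theorem lt_level {n j : ℕ} (hj : j < n) {x : ℝ} (hx : ((n : ℝ) - 1) / n < x) :
    (j : ℝ) / (j + 1) < level n j x := by
  refine lt_iterate_descend _ (by positivity) ?_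
  have h : (j : ℝ) + (n - 1 - j : ℕ) = n - 1 := by
    rw [Nat.sub_sub, Nat.cast_sub (by omega)]; push_cast; ring
  rw [h]
  simpa using hx

theorem level_pos {n j : ℕ} (hj : j < n) {x : ℝ} (hx : ((n : ℝ) - 1) / n < x) :
    0 < level n j x :=
  lt_of_le_of_lt (by positivity) (lt_level hj hx)

/-- The threshold i / (i + 1) for i iterates grows with i, and i = n - 1 - j is at most n - 1. Hence
all levels are monotone and continuous on the same ray. -/
theorem sub_div_le {n j : ℕ} (hj : j < n) :
    ((n - 1 - j : ℕ) : ℝ) / ((n - 1 - j : ℕ) + 1) ≤ ((n : ℝ) - 1) / n := by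
  have h : ((n - 1 - j : ℕ) : ℝ) = n - 1 - j := by
    rw [Nat.sub_sub, Nat.cast_sub (by omega)]; push_cast; ring
  have h' : (j : ℝ) + 1 ≤ n := by exact_mod_cast hj
  rw [h, div_le_div_iff₀ (by linarith) (by linarith [Nat.cast_nonneg (α := ℝ) j])]
  have := Nat.cast_nonneg (α := ℝ) j
  nlinarith

theorem level_le_level {n j : ℕ} (hj : j < n) {x y : ℝ} (hx : ((n : ℝ) - 1) / n < x)
    (hxy : x ≤ y) : level n j x ≤ level n j y :=
  iterate_descend_le _ ((sub_div_le hj).trans_lt hx) hxy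

theorem level_succ {n j : ℕ} (hj : j + 1 < n) (x : ℝ) :
    level n j x = descend (level n (j + 1) x) := by
  unfold level
  rw [← Function.iterate_succ_apply' descend]
  congr 1
  omega

theorem level_self {n : ℕ} (x : ℝ) : level n (n - 1) x = x := by
  simp [level]

theorem level_one (n j : ℕ) : level n j 1 = 1 :=
  Function.iterate_fixed (by norm_num [descend]) _

theorem continuousOn_level {n j : ℕ} (hj : j < n) :
    ContinuousOn (level n j) (Set.Ioi (((n : ℝ) - 1) / n)) :=
  (continuousOn_iterate_descend _).mono (Set.Ioi_subset_Ioi (sub_div_le hj))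

theorem continuousOn_level_fst {n j : ℕ} (hj : j < n) :
    ContinuousOn (fun p : ℝ × ℝ => level n j p.1) (paramDomain n) :=
  (continuousOn_level hj).comp continuousOn_fst fun _ hp => hp.1

theorem continuousOn_level_snd {n j : ℕ} (hj : j < n) :
    ContinuousOn (fun p : ℝ × ℝ => level n j p.2) (paramDomain n) :=
  (continuousOn_level hj).comp continuousOn_snd fun _ hp => hp.2

theorem continuousOn_rCoef {n j : ℕ} (hj : j < n) :
    ContinuousOn (rCoef n j) (paramDomain n) :=
  ((continuousOn_level_fst hj).add (continuousOn_level_snd hj)).div_const 2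

theorem continuousOn_epsCoef {n j : ℕ} (l : ℕ) (hj : j < n) :
    ContinuousOn (epsCoef n l j) (paramDomain n) := by
  have h1 := continuousOn_level_fst hj
  have h2 := continuousOn_level_snd hj
  unfold epsCoef
  fun_prop

theorem continuousOn_mainCoef {n l : ℕ} (hln : l ≤ n) :
    ContinuousOn (mainCoef n l) (paramDomain n) :=
  continuousOn_finsetProd _ fun _ hj =>
    (continuousOn_rCoef ((Finset.mem_range.1 hj).trans_le hln)).pow _

theorem continuousOn_errorCoef {n l : ℕ} (hln : l ≤ n) :
    ContinuousOn (errorCoef n l) (paramDomain n) :=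
  continuousOn_finsetSum _ fun _ hi =>
    (continuousOn_epsCoef l ((Finset.mem_range.1 hi).trans_le hln)).mul <|
      continuousOn_finsetProd _ fun _ hj =>
        (continuousOn_rCoef ((Finset.mem_Ioo.1 hj).2.trans_le hln)).pow _

theorem rCoef_one (n j : ℕ) : rCoef n j (1, 1) = 1 := by
  norm_num [rCoef, level_one]

theorem mainCoef_one (n l : ℕ) : mainCoef n l (1, 1) = 1 := by
  simp [mainCoef, rCoef_one]

theorem errorCoef_one (n l : ℕ) : errorCoef n l (1, 1) = 0 := by
  simp [errorCoef, epsCoef, level_one]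

theorem paramDomain_mem_nhds {n : ℕ} (hn : 1 ≤ n) : paramDomain n ∈ 𝓝 ((1 : ℝ), (1 : ℝ)) := by
  have hn' : (0 : ℝ) < n := by exact_mod_cast hn
  have h : ((n : ℝ) - 1) / n < 1 := by rw [div_lt_one hn']; linarith
  exact prod_mem_nhds (Ioi_mem_nhds h) (Ioi_mem_nhds h)

end Constants

/-! ### From eigenvalues to quadratic forms. -/

section SpectralTheorem

theorem inner_bounds_of_eigenvalues {E : Type*} [NormedAddCommGroup E] [InnerProductSpace ℝ E]
    [FiniteDimensional ℝ E] {T : E →ₗ[ℝ] E} (hT : T.IsSymmetric) {lo hi : ℝ}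
    (h : ∀ μ : ℝ, ∀ x : E, x ≠ 0 → T x = μ • x → μ ∈ Set.Icc lo hi) (x : E) :
    lo * inner ℝ x x ≤ inner ℝ (T x) x ∧ inner ℝ (T x) x ≤ hi * inner ℝ x x := by
  set b := hT.eigenvectorBasis rfl
  set ev := hT.eigenvalues rfl
  have hev : ∀ i, ev i ∈ Set.Icc lo hi := fun i =>
    h _ (b i) (b.orthonormal.ne_zero i) (hT.apply_eigenvectorBasis rfl i)
  have h1 : inner ℝ (T x) x = ∑ i, ev i * inner ℝ (b i) x ^ 2 := by
    rw [← b.sum_inner_mul_inner (T x) x]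
    refine Finset.sum_congr rfl fun i _ => ?_
    rw [hT x (b i), hT.apply_eigenvectorBasis rfl i, inner_smul_right, real_inner_comm x (b i)]
    simp only [RCLike.ofReal_real_eq_id, id_eq]
    ring
  have h2 : inner ℝ x x = ∑ i, inner ℝ (b i) x ^ 2 := by
    rw [← b.sum_inner_mul_inner x x]
    refine Finset.sum_congr rfl fun i _ => ?_
    rw [real_inner_comm x (b i)]
    ring
  rw [h1, h2, Finset.mul_sum, Finset.mul_sum]
  exact ⟨Finset.sum_le_sum fun i _ => mul_le_mul_of_nonneg_right (hev i).1 (sq_nonneg _),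
    Finset.sum_le_sum fun i _ => mul_le_mul_of_nonneg_right (hev i).2 (sq_nonneg _)⟩

/-- The function space already carries another norm, so the weighted inner product is passed as a
term and becomes an instance only inside the proof. -/
theorem core_bounds_of_eigenvalues {E : Type*} [AddCommGroup E] [Module ℝ E]
    [FiniteDimensional ℝ E] (c : InnerProductSpace.Core ℝ E) (T : E →ₗ[ℝ] E)
    (hT : ∀ x y, c.inner (T x) y = c.inner x (T y)) {lo hi : ℝ}
    (h : ∀ μ : ℝ, ∀ x : E, x ≠ 0 → T x = μ • x → μ ∈ Set.Icc lo hi) (x : E) :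
    lo * c.inner x x ≤ c.inner (T x) x ∧ c.inner (T x) x ≤ hi * c.inner x x := by
  let := c.toNormedAddCommGroup
  let : InnerProductSpace ℝ E := InnerProductSpace.ofCore c.toCore
  exact inner_bounds_of_eigenvalues (T := T) hT h x

/-- Bounds for the quadratic form of an operator that is symmetric for a weighted inner product
and kills the constants, in terms of its eigenvectors orthogonal to the constants. -/
theorem weighted_bounds_of_eigenvalues {ι : Type*} [Fintype ι] {a : ι → ℝ} (ha : ∀ u, 0 < a u)
    (T : Module.End ℝ (ι → ℝ)) (hT : ∀ φ ψ, ∑ u, a u * T φ u * ψ u = ∑ u, a u * φ u * T ψ u)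
    (hone : T (fun _ => 1) = 0) {lo hi : ℝ}
    (h : ∀ (μ : ℝ) (φ : ι → ℝ), φ ≠ 0 → ∑ u, a u * φ u = 0 → T φ = μ • φ → μ ∈ Set.Icc lo hi)
    (φ : ι → ℝ) (hφ : ∑ u, a u * φ u = 0) :
    lo * ∑ u, a u * φ u ^ 2 ≤ ∑ u, a u * T φ u * φ u ∧
      ∑ u, a u * T φ u * φ u ≤ hi * ∑ u, a u * φ u ^ 2 := by
  -- The orthogonal complement of the constants for the weighted inner product. It is invariant
  -- because the symmetric operator kills the constants.
  let S : Submodule ℝ (ι → ℝ) :=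
    { carrier := {φ | ∑ u, a u * φ u = 0}
      add_mem' := by
        intro x y hx hy
        simp only [Set.mem_ofPred_eq, Pi.add_apply, mul_add, Finset.sum_add_distrib] at *
        rw [hx, hy, add_zero]
      zero_mem' := by simp
      smul_mem' := by
        intro r x hx
        simp only [Set.mem_ofPred_eq, Pi.smul_apply, smul_eq_mul] at *
        rw [Finset.sum_congr rfl fun u _ => mul_left_comm (a u) r (x u), ← Finset.mul_sum, hx,
          mul_zero] }
  have hS : ∀ φ, φ ∈ S ↔ ∑ u, a u * φ u = 0 := fun φ => Iff.rfl
  have hTS : ∀ φ ∈ S, T φ ∈ S := by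
    intro φ _
    have := hT φ (fun _ => 1)
    rw [hone] at this
    simpa [hS] using this
  let c : InnerProductSpace.Core ℝ S :=
    { inner := fun x y => ∑ u, a u * x.1 u * y.1 u
      conj_inner_symm := fun x y => by
        simp only [conj_trivial]
        exact Finset.sum_congr rfl fun u _ => by ring
      re_inner_nonneg := fun x => by
        simp only [RCLike.re_to_real]
        exact Finset.sum_nonneg fun u _ => by nlinarith [ha u, mul_self_nonneg (x.1 u)]
      add_left := fun x y z => by
        simp only [Submodule.coe_add, Pi.add_apply, ← Finset.sum_add_distrib]
        exact Finset.sum_congr rfl fun u _ => by ring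
      smul_left := fun x y r => by
        simp only [Submodule.coe_smul, Pi.smul_apply, smul_eq_mul, conj_trivial, Finset.mul_sum]
        exact Finset.sum_congr rfl fun u _ => by ring
      definite := fun x hx => by
        have h0 : ∀ u ∈ Finset.univ, 0 ≤ a u * x.1 u * x.1 u := fun u _ => by
          nlinarith [ha u, mul_self_nonneg (x.1 u)]
        have h1 := (Finset.sum_eq_zero_iff_of_nonneg h0).1 hx
        ext u
        have h2 := h1 u (Finset.mem_univ u)
        rw [mul_assoc] at h2
        simpa [(ha u).ne'] using h2 }
  have key := core_bounds_of_eigenvalues c (T.restrict hTS) (fun x y => hT x.1 y.1)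
    (fun μ x hx hTx => h μ x.1 (fun h0 => hx (Subtype.ext h0)) x.2 (congrArg Subtype.val hTx))
    ⟨φ, hφ⟩
  have hsq : ∑ u, a u * φ u ^ 2 = ∑ u, a u * φ u * φ u :=
    Finset.sum_congr rfl fun u _ => by ring
  rw [hsq]
  exact key

end SpectralTheorem

/-! ### Balanced weights, Dirichlet forms of links and spectral descent. -/

section BalancedWeights

variable {V : Type*} [Fintype V] [DecidableEq V]

/-- The weight of the vertex `u` in the link of `τ`, for a function `w` on all sets of vertices;
zero if `u ∈ τ`. -/
def linkVertex (w : Finset V → ℝ) (τ : Finset V) (u : V) : ℝ :=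
  if u ∈ τ then 0 else w (insert u τ)

/-- The weight of the edge `{u, v}` in the link of `τ`; zero unless `u`, `v` are distinct vertices
outside `τ`. -/
def linkEdge (w : Finset V → ℝ) (τ : Finset V) (u v : V) : ℝ :=
  if u ∈ τ then 0 else linkVertex w (insert u τ) v

/-- A weight function extended by zero to the sets that are not simplices. -/
structure IsBalanced (w : Finset V → ℝ) (n : ℕ) : Prop where
  nonneg : ∀ s, s.card ≤ n + 1 → 0 ≤ w s
  sum_eq : ∀ s, s.card ≤ n → ∑ u, linkVertex w s u = w s

/-- The Dirichlet form of the weighted graph underlying the link of `τ`. -/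
def linkEnergy (w : Finset V → ℝ) (τ : Finset V) (φ : V → ℝ) : ℝ :=
  ∑ u, linkVertex w τ u * φ u ^ 2 - ∑ u, ∑ v, linkEdge w τ u v * φ u * φ v

/-- `w τ` times the variance of `φ` on the vertices of the link of `τ`. -/
noncomputable def linkVariance (w : Finset V → ℝ) (τ : Finset V) (φ : V → ℝ) : ℝ :=
  ∑ u, linkVertex w τ u * φ u ^ 2 - (∑ u, linkVertex w τ u * φ u) ^ 2 / w τ

/-- The nonzero spectrum of the Laplacian of the link of `τ` lies in `[lo, hi]`, in terms of
quadratic forms. -/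
def LinkBounds (w : Finset V → ℝ) (τ : Finset V) (lo hi : ℝ) : Prop :=
  ∀ φ : V → ℝ, lo * linkVariance w τ φ ≤ linkEnergy w τ φ ∧
    linkEnergy w τ φ ≤ hi * linkVariance w τ φ

omit [Fintype V] in
theorem linkEdge_eq (w : Finset V → ℝ) (τ : Finset V) (u v : V) :
    linkEdge w τ u v = if u ∈ τ ∨ v ∈ τ ∨ u = v then 0 else w (insert u (insert v τ)) := by
  unfold linkEdge linkVertex
  rw [Finset.insert_comm]
  by_cases h1 : u ∈ τ <;> by_cases h2 : v ∈ τ <;> by_cases h3 : u = v <;>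
    simp [h1, h2, h3, eq_comm (a := v)]

omit [Fintype V] in
theorem linkEdge_comm (w : Finset V → ℝ) (τ : Finset V) (u v : V) :
    linkEdge w τ u v = linkEdge w τ v u := by
  rw [linkEdge_eq, linkEdge_eq, Finset.insert_comm]
  congr 1
  simp only [eq_iff_iff]
  tauto

omit [Fintype V] in
theorem linkEdge_self (w : Finset V → ℝ) (τ : Finset V) (u : V) : linkEdge w τ u u = 0 := by
  simp [linkEdge_eq]

namespace IsBalanced

variable {w : Finset V → ℝ} {n : ℕ} (hw : IsBalanced w n) {τ : Finset V}
include hw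

theorem linkVertex_nonneg (hτ : τ.card ≤ n) (u : V) : 0 ≤ linkVertex w τ u := by
  unfold linkVertex
  split_ifs with h
  · exact le_rfl
  · exact hw.nonneg _ (by rw [Finset.card_insert_of_notMem h]; omega)

theorem linkEdge_nonneg (hτ : τ.card + 1 ≤ n) (u v : V) : 0 ≤ linkEdge w τ u v := by
  unfold linkEdge
  split_ifs with h
  · exact le_rfl
  · exact hw.linkVertex_nonneg (by rw [Finset.card_insert_of_notMem h]; omega) _

theorem sum_linkEdge (hτ : τ.card + 1 ≤ n) (u : V) :
    ∑ v, linkEdge w τ u v = linkVertex w τ u := by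
  unfold linkEdge
  by_cases h : u ∈ τ
  · simp [h, linkVertex]
  · simp only [h, if_false]
    rw [hw.sum_eq _ (by rw [Finset.card_insert_of_notMem h]; omega), linkVertex, if_neg h]

theorem sum_linkEdge_left (hτ : τ.card + 1 ≤ n) (v : V) :
    ∑ u, linkEdge w τ u v = linkVertex w τ v := by
  rw [← hw.sum_linkEdge hτ v]
  exact Finset.sum_congr rfl fun u _ => linkEdge_comm _ _ _ _

/-- The balance equation for τ ∪ {v, x}: it recovers the edge weights of a link from those of the
links one dimension lower. -/
theorem sum_linkEdge_insert (hτ : τ.card + 2 ≤ n) (v x : V) :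
    ∑ u, (if u ∈ τ then 0 else linkEdge w (insert u τ) v x) = linkEdge w τ v x := by
  rw [linkEdge_eq w τ v x]
  split_ifs with h
  · refine Finset.sum_eq_zero fun u _ => ?_
    rw [linkEdge_eq]
    refine ite_eq_left_iff.2 fun _ => if_pos ?_
    simp only [Finset.mem_insert]
    tauto
  · push Not at h
    have hcard : (insert v (insert x τ)).card ≤ n := by
      rw [Finset.card_insert_of_notMem (by simp [h.1, h.2.2]),
        Finset.card_insert_of_notMem h.2.1]
      omega
    rw [← hw.sum_eq _ hcard]
    refine Finset.sum_congr rfl fun u _ => ?_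
    rw [linkEdge_eq]
    unfold linkVertex
    simp only [Finset.mem_insert]
    by_cases h1 : u ∈ τ
    · simp [h1]
    by_cases h2 : u = v
    · simp [h2]
    by_cases h3 : u = x
    · simp [h3]
    rw [if_neg h1, if_neg (by
      push Not
      exact ⟨⟨Ne.symm h2, h.1⟩, ⟨Ne.symm h3, h.2.1⟩, h.2.2⟩), if_neg (by tauto)]
    congr 1
    ext y
    simp only [Finset.mem_insert]
    tauto

/-- The Dirichlet form as a sum of squares. -/
theorem linkEnergy_eq (hτ : τ.card + 1 ≤ n) (φ : V → ℝ) :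
    linkEnergy w τ φ = (∑ u, ∑ v, linkEdge w τ u v * (φ u - φ v) ^ 2) / 2 := by
  have h1 : ∑ u, ∑ v, linkEdge w τ u v * φ u ^ 2 = ∑ u, linkVertex w τ u * φ u ^ 2 :=
    Finset.sum_congr rfl fun u _ => by rw [← Finset.sum_mul, hw.sum_linkEdge hτ]
  have h2 : ∑ u, ∑ v, linkEdge w τ u v * φ v ^ 2 = ∑ u, linkVertex w τ u * φ u ^ 2 := by
    rw [Finset.sum_comm]
    exact Finset.sum_congr rfl fun u _ => by rw [← Finset.sum_mul, hw.sum_linkEdge_left hτ]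
  have h3 : ∑ u, ∑ v, linkEdge w τ u v * (φ u - φ v) ^ 2 =
      ∑ u, ∑ v, linkEdge w τ u v * φ u ^ 2 + ∑ u, ∑ v, linkEdge w τ u v * φ v ^ 2 -
        2 * ∑ u, ∑ v, linkEdge w τ u v * φ u * φ v := by
    simp only [Finset.mul_sum, ← Finset.sum_add_distrib, ← Finset.sum_sub_distrib]
    exact Finset.sum_congr rfl fun u _ => Finset.sum_congr rfl fun v _ => by ring
  rw [h3, h1, h2, linkEnergy]
  ring

theorem linkEnergy_nonneg (hτ : τ.card + 1 ≤ n) (φ : V → ℝ) : 0 ≤ linkEnergy w τ φ := by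
  rw [hw.linkEnergy_eq hτ]
  exact div_nonneg (Finset.sum_nonneg fun u _ => Finset.sum_nonneg fun v _ =>
    mul_nonneg (hw.linkEdge_nonneg hτ u v) (sq_nonneg _)) two_pos.le

/-- Cauchy–Schwarz, since the vertex weights of the link have total mass `w τ`. -/
theorem linkVariance_nonneg (hτ : τ.card ≤ n) (φ : V → ℝ) : 0 ≤ linkVariance w τ φ := by
  have h := Finset.sum_sq_le_sum_mul_sum_of_sq_le_mul Finset.univ
    (r := fun u => linkVertex w τ u * φ u) (f := fun u => linkVertex w τ u)
    (g := fun u => linkVertex w τ u * φ u ^ 2)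
    (fun u _ => hw.linkVertex_nonneg hτ u)
    (fun u _ => mul_nonneg (hw.linkVertex_nonneg hτ u) (sq_nonneg _))
    (fun u _ => le_of_eq (by ring))
  rw [hw.sum_eq τ hτ] at h
  unfold linkVariance
  rcases (hw.nonneg τ (by omega)).eq_or_lt with h0 | h0
  · rw [← h0, div_zero, sub_zero]
    exact Finset.sum_nonneg fun u _ => mul_nonneg (hw.linkVertex_nonneg hτ u) (sq_nonneg _)
  · rw [sub_nonneg, div_le_iff₀ h0]
    linarith

theorem linkVariance_le (hτ : τ.card ≤ n) (φ : V → ℝ) :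
    linkVariance w τ φ ≤ ∑ u, linkVertex w τ u * φ u ^ 2 :=
  sub_le_self _ (div_nonneg (sq_nonneg _) (hw.nonneg τ (by omega)))

theorem linkEnergy_sub_const (hτ : τ.card + 1 ≤ n) (φ : V → ℝ) (c : ℝ) :
    linkEnergy w τ (fun u => φ u - c) = linkEnergy w τ φ := by
  simp only [hw.linkEnergy_eq hτ, sub_sub_sub_cancel_right]

/-- It is enough to bound the Dirichlet form on functions orthogonal to the constants. -/
theorem linkBounds_of_sum_eq_zero (hτ : τ.card + 1 ≤ n) {lo hi : ℝ} (hpos : 0 < w τ)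
    (h : ∀ φ : V → ℝ, ∑ u, linkVertex w τ u * φ u = 0 →
      lo * ∑ u, linkVertex w τ u * φ u ^ 2 ≤ linkEnergy w τ φ ∧
        linkEnergy w τ φ ≤ hi * ∑ u, linkVertex w τ u * φ u ^ 2) :
    LinkBounds w τ lo hi := by
  intro φ
  set s := ∑ u, linkVertex w τ u * φ u with hs
  have h1 := hw.sum_eq τ (by omega)
  have h2 : ∑ u, linkVertex w τ u * (φ u - s / w τ) = 0 := by
    simp only [mul_sub, Finset.sum_sub_distrib, ← Finset.sum_mul]
    rw [h1, ← hs]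
    field_simp
    ring
  have h3 : ∑ u, linkVertex w τ u * (φ u - s / w τ) ^ 2 = linkVariance w τ φ := by
    have : ∀ u, linkVertex w τ u * (φ u - s / w τ) ^ 2 = linkVertex w τ u * φ u ^ 2 -
        2 * (s / w τ) * (linkVertex w τ u * φ u) + (s / w τ) ^ 2 * linkVertex w τ u :=
      fun u => by ring
    simp only [this, Finset.sum_add_distrib, Finset.sum_sub_distrib, ← Finset.mul_sum]
    rw [h1, linkVariance, ← hs]
    field_simp
    ring
  have := h _ h2
  rwa [h3, hw.linkEnergy_sub_const hτ] at this

theorem eq_zero_of_weight_eq_zero (hτ : τ.card ≤ n) (h0 : w τ = 0) (u : V) :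
    linkVertex w τ u = 0 := by
  have h := hw.sum_eq τ hτ
  rw [h0, Finset.sum_eq_zero_iff_of_nonneg fun u _ => hw.linkVertex_nonneg hτ u] at h
  exact h u (Finset.mem_univ u)

theorem linkEdge_eq_zero (hτ : τ.card + 1 ≤ n) {u : V} (h0 : linkVertex w τ u = 0) (v : V) :
    linkEdge w τ u v = 0 := by
  have h := hw.sum_linkEdge hτ u
  rw [h0, Finset.sum_eq_zero_iff_of_nonneg fun v _ => hw.linkEdge_nonneg hτ u v] at h
  exact h v (Finset.mem_univ v)

/-- Here both forms vanish identically, so bounds proved for simplices extend to all sets of the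
same size. -/
theorem linkBounds_of_weight_eq_zero (hτ : τ.card + 1 ≤ n) (h0 : w τ = 0) (lo hi : ℝ) :
    LinkBounds w τ lo hi := by
  intro φ
  have h1 := hw.eq_zero_of_weight_eq_zero (by omega) h0
  have h2 := fun u => hw.linkEdge_eq_zero hτ (h1 u)
  simp [linkVariance, linkEnergy, h1, h2]

/-- Descent of spectral bounds: the bounds `lo`, `hi` for the links of all `insert u τ` give the
bounds `2 - 1 / lo`, `2 - 1 / hi` for the positive eigenvalues of the link of `τ`. -/
theorem descend_eigenvalue (hτ : τ.card + 2 ≤ n) {lo hi : ℝ} (hlo : 0 < lo) (hhi : 0 < hi)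
    (h : ∀ u ∉ τ, LinkBounds w (insert u τ) lo hi) {μ : ℝ} (hμ : 0 < μ) {φ : V → ℝ}
    (hφ : 0 < ∑ u, linkVertex w τ u * φ u ^ 2)
    (heig : ∀ u, ∑ v, linkEdge w τ u v * φ v = (1 - μ) * (linkVertex w τ u * φ u)) :
    descend lo ≤ μ ∧ μ ≤ descend hi := by
  set N := ∑ u, linkVertex w τ u * φ u ^ 2 with hN
  have hE : linkEnergy w τ φ = μ * N := by
    have : ∀ u, ∑ v, linkEdge w τ u v * φ u * φ v =
        (1 - μ) * (linkVertex w τ u * φ u ^ 2) := fun u => by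
      calc ∑ v, linkEdge w τ u v * φ u * φ v = φ u * ∑ v, linkEdge w τ u v * φ v := by
            rw [Finset.mul_sum]; exact Finset.sum_congr rfl fun v _ => by ring
        _ = _ := by rw [heig]; ring
    simp only [linkEnergy, this, ← Finset.mul_sum, ← hN]
    ring
  -- Garland's localization of the energy: the vertex weights in the link of `insert u τ` are the
  -- edge weights at u in the link of τ, and the edge terms add up by `sum_linkEdge_insert`.
  have hsum : ∑ u, (if u ∈ τ then 0 else linkEnergy w (insert u τ) φ) = linkEnergy w τ φ := by
    have h1 : ∀ u, (if u ∈ τ then 0 else linkEnergy w (insert u τ) φ) =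
        ∑ v, linkEdge w τ u v * φ v ^ 2 -
          ∑ v, ∑ x, (if u ∈ τ then 0 else linkEdge w (insert u τ) v x) * φ v * φ x := by
      intro u
      unfold linkEnergy
      rw [show linkEdge w τ u = fun v => if u ∈ τ then 0 else linkVertex w (insert u τ) v from rfl]
      split_ifs <;> simp
    simp only [h1, Finset.sum_sub_distrib]
    unfold linkEnergy
    congr 1
    · rw [Finset.sum_comm]
      exact Finset.sum_congr rfl fun v _ => by
        rw [← Finset.sum_mul, hw.sum_linkEdge_left (by omega)]
    · rw [Finset.sum_comm]
      refine Finset.sum_congr rfl fun v _ => ?_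
      rw [Finset.sum_comm]
      refine Finset.sum_congr rfl fun x _ => ?_
      rw [← Finset.sum_mul, ← Finset.sum_mul, hw.sum_linkEdge_insert hτ]
  -- The eigenvalue equation says that φ has mean (1 - μ) φ(u) on the link of `insert u τ`. The
  -- variances therefore add up to N - (1 - μ)² N.
  have hvar : ∑ u, (if u ∈ τ then 0 else linkVariance w (insert u τ) φ) = μ * (2 - μ) * N := by
    have h1 : ∀ u, (if u ∈ τ then 0 else linkVariance w (insert u τ) φ) =
        ∑ v, linkEdge w τ u v * φ v ^ 2 - (1 - μ) ^ 2 * (linkVertex w τ u * φ u ^ 2) := by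
      intro u
      have h2 := heig u
      by_cases hu : u ∈ τ
      · simp [hu, linkVertex, linkEdge]
      · simp only [linkEdge, hu, if_false] at h2 ⊢
        unfold linkVariance
        rw [h2]
        congr 1
        simp only [linkVertex, hu, if_false]
        by_cases h0 : w (insert u τ) = 0
        · simp [h0]
        · field_simp
    simp only [h1, Finset.sum_sub_distrib, ← Finset.mul_sum, ← hN]
    rw [Finset.sum_comm]
    have h3 : ∑ v, ∑ u, linkEdge w τ u v * φ v ^ 2 = N :=
      Finset.sum_congr rfl fun v _ => by
        rw [← Finset.sum_mul, hw.sum_linkEdge_left (by omega)]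
    rw [h3]
    ring
  have hl : lo * (μ * (2 - μ) * N) ≤ μ * N := by
    rw [← hvar, ← hE, ← hsum, Finset.mul_sum]
    refine Finset.sum_le_sum fun u _ => ?_
    split_ifs with hu
    · simp
    · exact (h u hu φ).1
  have hh : μ * N ≤ hi * (μ * (2 - μ) * N) := by
    rw [← hvar, ← hE, ← hsum, Finset.mul_sum]
    refine Finset.sum_le_sum fun u _ => ?_
    split_ifs with hu
    · simp
    · exact (h u hu φ).2
  have hμN : 0 < μ * N := mul_pos hμ hφ
  have hl' : lo * (2 - μ) ≤ 1 := by
    by_contra! hc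
    nlinarith
  have hh' : 1 ≤ hi * (2 - μ) := by
    by_contra! hc
    nlinarith
  have e1 : 2 - μ ≤ 1 / lo := by rw [le_div_iff₀ hlo]; linarith
  have e2 : 1 / hi ≤ 2 - μ := by rw [div_le_iff₀ hhi]; linarith
  unfold descend
  constructor <;> linarith

/-- The upper bound for the nonzero spectrum of a link is at least `1`. -/
theorem one_le_of_linkBounds (hτ : τ.card + 1 ≤ n) {lo hi : ℝ} (hlo : 0 ≤ lo) (hle : lo ≤ hi)
    (h : LinkBounds w τ lo hi) {u : V} (hu : 0 < linkVertex w τ u) : 1 ≤ hi := by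
  -- The indicator of one vertex has energy equal to its weight, as there are no loops, and variance
  -- at most that weight.
  have h1 := (h (Pi.single u 1)).2
  have hE : linkEnergy w τ (Pi.single u 1) = linkVertex w τ u := by
    simp [linkEnergy, Pi.single_apply, linkEdge_self]
  have h2 := hw.linkVariance_le (τ := τ) (by omega) (Pi.single u 1)
  have h3 : ∑ v, linkVertex w τ v * (Pi.single u 1 : V → ℝ) v ^ 2 = linkVertex w τ u := by
    simp [Pi.single_apply]
  rw [h3] at h2
  rw [hE] at h1
  have h4 := mul_le_mul_of_nonneg_left h2 (hlo.trans hle)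
  by_contra! hc
  nlinarith

end IsBalanced

end BalancedWeights

/-! ### Weighted complexes as balanced weights; spectral bounds for all links. -/

section LinksOfComplexes

variable {V : Type*} [Fintype V] [DecidableEq V]
  {X : PreAbstractSimplicialComplex V} {m : Finset V → ℝ} {n : ℕ}

open scoped Classical in
/-- The weight `m`, replaced by zero on the sets that are not simplices. -/
noncomputable def cellWeight (X : PreAbstractSimplicialComplex V) (m : Finset V → ℝ)
    (s : Finset V) : ℝ :=
  if s = ∅ ∨ s ∈ X then m s else 0

theorem mem_cells {c : ℕ} {s : Finset V} : s ∈ cells X c ↔ s.card = c ∧ (s = ∅ ∨ s ∈ X) := by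
  simp [cells]

omit [DecidableEq V] in
theorem mem_verts {v : V} : v ∈ verts X ↔ {v} ∈ X := by
  simp [verts]

omit [Fintype V] [DecidableEq V] in
theorem mem_of_subset {s t : Finset V} (hs : s ∈ X) (hts : t ⊆ s) (ht : t.Nonempty) : t ∈ X :=
  (X.isRelLowerSet_faces hs).2 hts ht

theorem cellWeight_of_mem_cells {c : ℕ} {s : Finset V} (hs : s ∈ cells X c) :
    cellWeight X m s = m s :=
  if_pos (mem_cells.1 hs).2

omit [Fintype V] in
theorem cellWeight_insert {τ : Finset V} {u : V} (h : insert u τ ∈ X) :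
    cellWeight X m (insert u τ) = m (insert u τ) :=
  if_pos (Or.inr h)

omit [Fintype V] in
theorem cellWeight_insert_eq_zero {τ : Finset V} {u : V} (h : insert u τ ∉ X) :
    cellWeight X m (insert u τ) = 0 :=
  if_neg (by simp [h])

theorem mem_verts_link {τ : Finset V} {v : V} :
    v ∈ verts (link X τ) ↔ v ∉ τ ∧ insert v τ ∈ X := by
  rw [mem_verts, Finset.insert_eq, Finset.union_comm]
  change ({v} : Finset V).Nonempty ∧ Disjoint τ {v} ∧ τ ∪ {v} ∈ X ↔ _
  simp

omit [Fintype V] in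
theorem pair_mem_link {τ : Finset V} {u v : V} :
    ({u, v} : Finset V) ∈ link X τ ↔ u ∉ τ ∧ v ∉ τ ∧ insert u (insert v τ) ∈ X := by
  have h : insert u (insert v τ) = τ ∪ {u, v} := by
    ext
    simp only [Finset.mem_insert, Finset.mem_union, Finset.mem_singleton]
    tauto
  rw [h]
  change ({u, v} : Finset V).Nonempty ∧ Disjoint τ {u, v} ∧ τ ∪ {u, v} ∈ X ↔ _
  simp [and_assoc]

theorem cellWeight_pos (hm : IsWeight X n m) {c : ℕ} (hc : c ≤ n + 1) {s : Finset V}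
    (hs : s ∈ cells X c) : 0 < cellWeight X m s := by
  rw [cellWeight_of_mem_cells hs]
  exact hm.1 c hc s hs

/-- The simplices one dimension above s arise by adding a vertex of the link of s. If s is no
simplex, no superset of it is one, and both sides vanish. -/
theorem isBalanced_cellWeight (hm : IsWeight X n m) : IsBalanced (cellWeight X m) n where
  nonneg s hs := by
    by_cases h : s = ∅ ∨ s ∈ X
    · exact (cellWeight_pos hm hs (mem_cells.2 ⟨rfl, h⟩)).le
    · rw [cellWeight, if_neg h]
  sum_eq s hs := by
    by_cases h : s = ∅ ∨ s ∈ X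
    · have hcell : s ∈ cells X s.card := mem_cells.2 ⟨rfl, h⟩
      rw [cellWeight_of_mem_cells hcell, ← hm.2 _ hs s hcell]
      have h1 : ∑ u, linkVertex (cellWeight X m) s u =
          ∑ u ∈ verts (link X s), m (insert u s) := by
        rw [← Finset.sum_subset (Finset.subset_univ (verts (link X s)))]
        · refine Finset.sum_congr rfl fun u hu => ?_
          obtain ⟨h1, h2⟩ := mem_verts_link.1 hu
          rw [linkVertex, if_neg h1, cellWeight_insert h2]
        · intro u _ hu
          unfold linkVertex
          split_ifs with h1
          · rfl
          · exact cellWeight_insert_eq_zero fun h2 => hu (mem_verts_link.2 ⟨h1, h2⟩)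
      rw [h1]
      refine Finset.sum_bij (fun u _ => insert u s) ?_ ?_ ?_ fun _ _ => rfl
      · intro u hu
        obtain ⟨h1, h2⟩ := mem_verts_link.1 hu
        exact Finset.mem_filter.2 ⟨mem_cells.2 ⟨Finset.card_insert_of_notMem h1, Or.inr h2⟩,
          Finset.subset_insert u s⟩
      · intro u hu v _ huv
        have h1 : u ∈ insert v s := huv ▸ Finset.mem_insert_self u s
        exact (Finset.mem_insert.1 h1).resolve_right (mem_verts_link.1 hu).1
      · intro σ hσ
        obtain ⟨h1, h2⟩ := Finset.mem_filter.1 hσ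
        obtain ⟨h3, h4⟩ := mem_cells.1 h1
        obtain ⟨u, hu, rfl⟩ := Finset.exists_eq_insert_iff.2 ⟨h2, h3.symm⟩
        exact ⟨u, mem_verts_link.2 ⟨hu, h4.resolve_left (Finset.insert_ne_empty u s)⟩, rfl⟩
    · rw [cellWeight, if_neg h]
      push Not at h
      refine Finset.sum_eq_zero fun u _ => ?_
      unfold linkVertex
      split_ifs
      · rfl
      · exact cellWeight_insert_eq_zero fun h2 =>
          h.2 (mem_of_subset h2 (Finset.subset_insert u s) h.1)

theorem linkVertex_cellWeight {τ : Finset V} {u : V} (hu : u ∈ verts (link X τ)) :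
    linkVertex (cellWeight X m) τ u = linkWeight m τ {u} := by
  obtain ⟨h1, h2⟩ := mem_verts_link.1 hu
  rw [linkVertex, if_neg h1, cellWeight_insert h2, linkWeight, Finset.insert_eq, Finset.union_comm]

theorem linkVertex_cellWeight_eq_zero {τ : Finset V} {u : V} (hu : u ∉ verts (link X τ)) :
    linkVertex (cellWeight X m) τ u = 0 := by
  unfold linkVertex
  split_ifs with h
  · rfl
  · exact cellWeight_insert_eq_zero fun h2 => hu (mem_verts_link.2 ⟨h, h2⟩)

theorem linkVertex_cellWeight_pos (hm : IsWeight X n m) {τ : Finset V} (hτ : τ.card ≤ n) {u : V}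
    (hu : u ∈ verts (link X τ)) : 0 < linkVertex (cellWeight X m) τ u := by
  obtain ⟨h1, h2⟩ := mem_verts_link.1 hu
  rw [linkVertex, if_neg h1]
  exact cellWeight_pos hm (by rw [Finset.card_insert_of_notMem h1]; omega)
    (mem_cells.2 ⟨rfl, Or.inr h2⟩)

open scoped Classical in
theorem linkEdge_cellWeight {τ : Finset V} (u v : {v // v ∈ verts (link X τ)}) :
    linkEdge (cellWeight X m) τ u.1 v.1 =
      if (skeletonGraph (link X τ)).Adj v u then linkWeight m τ {v.1, u.1} else 0 := by
  have hu := (mem_verts_link.1 u.2).1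
  have hv := (mem_verts_link.1 v.2).1
  have hset : insert u.1 (insert v.1 τ) = τ ∪ {v.1, u.1} := by
    ext
    simp only [Finset.mem_insert, Finset.mem_union, Finset.mem_singleton]
    tauto
  have hadj : (skeletonGraph (link X τ)).Adj v u ↔ v ≠ u ∧ ({v.1, u.1} : Finset V) ∈ link X τ :=
    Iff.rfl
  rw [linkEdge_eq, hadj, pair_mem_link, Finset.insert_comm]
  by_cases huv : u = v
  · simp [huv]
  · have huv' : u.1 ≠ v.1 := fun h => huv (Subtype.ext h)
    rw [if_neg (by tauto)]
    split_ifs with h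
    · rw [cellWeight_insert h.2.2.2, linkWeight, Finset.insert_comm, hset]
    · exact cellWeight_insert_eq_zero fun h2 => h ⟨Ne.symm huv, hv, hu, h2⟩

/-- Sums over all of `V` of functions that vanish where the link has no vertex. -/
theorem sum_eq_sum_verts {τ : Finset V} {f : V → ℝ} (hf : ∀ u ∉ verts (link X τ), f u = 0) :
    ∑ u, f u = ∑ u : {v // v ∈ verts (link X τ)}, f u.1 := by
  rw [← Finset.sum_subset (Finset.subset_univ (verts (link X τ))) fun u _ hu => hf u hu]
  exact (Finset.sum_coe_sort _ f).symm

/-- Sums over all of `V` replace those over the vertices of the link, so that one function φ can be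
tested in different links at once. -/
theorem linkVertex_mul_upLaplacian (hm : IsWeight X n m) {τ : Finset V} (hτ : τ.card + 1 ≤ n)
    (φ : V → ℝ) (u : {v // v ∈ verts (link X τ)}) :
    linkVertex (cellWeight X m) τ u.1 *
        upLaplacian (link X τ) (linkWeight m τ) (fun v => φ v.1) u =
      linkVertex (cellWeight X m) τ u.1 * φ u.1 -
        ∑ v, linkEdge (cellWeight X m) τ u.1 v * φ v := by
  classical
  have hw := isBalanced_cellWeight hm
  have hpos := linkVertex_cellWeight_pos hm (by omega) u.2
  have hz : ∀ v ∉ verts (link X τ), linkEdge (cellWeight X m) τ u.1 v = 0 := fun v hv => by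
    rw [linkEdge_comm]
    exact hw.linkEdge_eq_zero hτ (linkVertex_cellWeight_eq_zero hv) _
  have h1 : linkVertex (cellWeight X m) τ u.1 * φ u.1 -
        ∑ v, linkEdge (cellWeight X m) τ u.1 v * φ v =
      ∑ v, linkEdge (cellWeight X m) τ u.1 v * (φ u.1 - φ v) := by
    rw [← hw.sum_linkEdge hτ, Finset.sum_mul, ← Finset.sum_sub_distrib]
    exact Finset.sum_congr rfl fun v _ => by ring
  rw [h1, sum_eq_sum_verts (τ := τ) (X := X) fun v hv => by rw [hz v hv, zero_mul]]
  simp only [upLaplacian, LinearMap.coe_mk, AddHom.coe_mk, Finset.mul_sum, Finset.sum_filter]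
  refine Finset.sum_congr rfl fun v _ => ?_
  rw [linkEdge_cellWeight, linkVertex_cellWeight u.2]
  rw [linkVertex_cellWeight u.2] at hpos
  split_ifs
  · field_simp
  · simp

/-- The Laplacian of the link as a quadratic form. -/
theorem sum_upLaplacian (hm : IsWeight X n m) {τ : Finset V} (hτ : τ.card + 1 ≤ n) (φ : V → ℝ) :
    ∑ u : {v // v ∈ verts (link X τ)}, linkVertex (cellWeight X m) τ u.1 *
        upLaplacian (link X τ) (linkWeight m τ) (fun v => φ v.1) u * φ u.1 =
      linkEnergy (cellWeight X m) τ φ := by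
  have hw := isBalanced_cellWeight hm
  simp only [linkVertex_mul_upLaplacian hm hτ]
  rw [← sum_eq_sum_verts (f := fun u => (linkVertex (cellWeight X m) τ u * φ u -
        ∑ v, linkEdge (cellWeight X m) τ u v * φ v) * φ u)]
  · simp only [sub_mul, Finset.sum_sub_distrib, linkEnergy, Finset.sum_mul]
    congr 1
    · exact Finset.sum_congr rfl fun u _ => by ring
    · exact Finset.sum_congr rfl fun u _ => Finset.sum_congr rfl fun v _ => by ring
  · intro u hu
    have h0 := linkVertex_cellWeight_eq_zero (m := m) hu
    simp [h0, hw.linkEdge_eq_zero hτ h0]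

theorem exists_extension {τ : Finset V} (φ : {v // v ∈ verts (link X τ)} → ℝ) :
    ∃ ψ : V → ℝ, (fun v : {v // v ∈ verts (link X τ)} => ψ v.1) = φ := by
  classical
  exact ⟨fun v => if h : v ∈ verts (link X τ) then φ ⟨v, h⟩ else 0, by ext v; simp [v.2]⟩

theorem sum_upLaplacian_symm (hm : IsWeight X n m) {τ : Finset V} (hτ : τ.card + 1 ≤ n)
    (φ ψ : {v // v ∈ verts (link X τ)} → ℝ) :
    ∑ u, linkVertex (cellWeight X m) τ u.1 * upLaplacian (link X τ) (linkWeight m τ) φ u * ψ u =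
      ∑ u, linkVertex (cellWeight X m) τ u.1 * φ u *
        upLaplacian (link X τ) (linkWeight m τ) ψ u := by
  have hne : ∀ u ∈ verts (link X τ), linkWeight m τ {u} ≠ 0 := fun u hu => by
    rw [← linkVertex_cellWeight hu]
    exact (linkVertex_cellWeight_pos hm (by omega) hu).ne'
  have h1 := inner_upLaplacian (link X τ) (linkWeight m τ) hne φ ψ
  have h2 := inner_upLaplacian (link X τ) (linkWeight m τ) hne ψ φ
  calc _ = ∑ u : {v // v ∈ verts (link X τ)}, linkWeight m τ {u.1} *
          upLaplacian (link X τ) (linkWeight m τ) φ u * ψ u :=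
        Finset.sum_congr rfl fun u _ => by rw [linkVertex_cellWeight u.2]
    _ = ∑ u : {v // v ∈ verts (link X τ)}, linkWeight m τ {u.1} *
          upLaplacian (link X τ) (linkWeight m τ) ψ u * φ u := by
        rw [h1, h2]
        exact Finset.sum_congr rfl fun u _ => Finset.sum_congr rfl fun v _ => by ring
    _ = _ := Finset.sum_congr rfl fun u _ => by rw [linkVertex_cellWeight u.2]; ring

/-- In a connected link, functions of energy zero are constant. -/
theorem eq_of_linkEnergy_eq_zero (hm : IsWeight X n m) {τ : Finset V} (hτ : τ.card + 1 ≤ n)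
    (hconn : (skeletonGraph (link X τ)).Connected) {φ : V → ℝ}
    (h0 : linkEnergy (cellWeight X m) τ φ = 0) {u v : V} (hu : u ∈ verts (link X τ))
    (hv : v ∈ verts (link X τ)) : φ u = φ v := by
  classical
  have hw := isBalanced_cellWeight hm
  have hnn : ∀ u v, 0 ≤ linkEdge (cellWeight X m) τ u v * (φ u - φ v) ^ 2 := fun u v =>
    mul_nonneg (hw.linkEdge_nonneg hτ u v) (sq_nonneg _)
  have hadj : ∀ a b : {v // v ∈ verts (link X τ)}, (skeletonGraph (link X τ)).Adj a b →
      φ a.1 = φ b.1 := by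
    intro a b hab
    rw [hw.linkEnergy_eq hτ, div_eq_zero_iff, or_iff_left two_ne_zero,
      Finset.sum_eq_zero_iff_of_nonneg fun u _ => Finset.sum_nonneg fun v _ => hnn u v] at h0
    have h1 := h0 a.1 (Finset.mem_univ _)
    rw [Finset.sum_eq_zero_iff_of_nonneg fun v _ => hnn _ v] at h1
    have h2 := h1 b.1 (Finset.mem_univ _)
    have h3 : linkEdge (cellWeight X m) τ a.1 b.1 ≠ 0 := by
      obtain ⟨hne, hX⟩ := hab
      obtain ⟨ha, hb, hX⟩ := pair_mem_link.1 hX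
      have hne' : a.1 ≠ b.1 := fun h => hne (Subtype.ext h)
      rw [linkEdge_eq, if_neg (by tauto)]
      refine (cellWeight_pos hm ?_ (mem_cells.2 ⟨rfl, Or.inr hX⟩)).ne'
      rw [Finset.card_insert_of_notMem (by simp [ha, hne']), Finset.card_insert_of_notMem hb]
      omega
    have h4 := (mul_eq_zero.1 h2).resolve_left h3
    linarith [pow_eq_zero_iff (two_ne_zero) |>.1 h4]
  obtain ⟨p⟩ := hconn.preconnected ⟨u, hu⟩ ⟨v, hv⟩
  have : ∀ {a b : {v // v ∈ verts (link X τ)}}, (skeletonGraph (link X τ)).Walk a b →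
      φ a.1 = φ b.1 := by
    intro a b p
    induction p with
    | nil => rfl
    | cons h _ ih => exact (hadj _ _ h).trans ih
  exact this p

/-- Bounds for the positive eigenvalues of the Laplacian of a connected link give bounds for its
quadratic form. -/
theorem linkBounds_of_eigenvalues (hm : IsWeight X n m) {τ : Finset V} {c : ℕ}
    (hτ : τ ∈ cells X c) (hc : c + 1 ≤ n) (hconn : (skeletonGraph (link X τ)).Connected)
    {lo hi : ℝ}
    (h : ∀ (μ : ℝ) (φ : {v // v ∈ verts (link X τ)} → ℝ), φ ≠ 0 → 0 < μ →
      upLaplacian (link X τ) (linkWeight m τ) φ = μ • φ → μ ∈ Set.Icc lo hi) :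
    LinkBounds (cellWeight X m) τ lo hi := by
  have hw := isBalanced_cellWeight hm
  have hcard : τ.card + 1 ≤ n := by rw [(mem_cells.1 hτ).1]; exact hc
  have ha : ∀ u : {v // v ∈ verts (link X τ)}, 0 < linkVertex (cellWeight X m) τ u.1 := fun u =>
    linkVertex_cellWeight_pos hm (by omega) u.2
  have hz : ∀ u ∉ verts (link X τ), linkVertex (cellWeight X m) τ u = 0 := fun u hu =>
    linkVertex_cellWeight_eq_zero hu
  refine hw.linkBounds_of_sum_eq_zero hcard (cellWeight_pos hm (by omega) hτ) fun φ hφ => ?_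
  rw [sum_eq_sum_verts (X := X) (τ := τ) fun u hu => by rw [hz u hu, zero_mul]] at hφ
  rw [sum_eq_sum_verts (X := X) (τ := τ) fun u hu => by rw [hz u hu, zero_mul],
    ← sum_upLaplacian hm hcard φ]
  refine weighted_bounds_of_eigenvalues ha _ (sum_upLaplacian_symm hm hcard) ?_ ?_ _ hφ
  · ext u
    simp [upLaplacian]
  · intro μ φ hφ0 hsum heig
    refine h μ φ hφ0 ?_ heig
    obtain ⟨ψ, rfl⟩ := exists_extension φ
    have hE := sum_upLaplacian hm hcard ψ
    rw [heig] at hE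
    have hpos : 0 < ∑ u : {v // v ∈ verts (link X τ)},
        linkVertex (cellWeight X m) τ u.1 * ψ u.1 ^ 2 := by
      obtain ⟨u, hu⟩ := Function.ne_iff.1 hφ0
      refine Finset.sum_pos' (fun v _ => mul_nonneg (ha v).le (sq_nonneg _))
        ⟨u, Finset.mem_univ _, mul_pos (ha u) (sq_pos_iff.2 hu)⟩
    have hE' : μ * ∑ u : {v // v ∈ verts (link X τ)},
        linkVertex (cellWeight X m) τ u.1 * ψ u.1 ^ 2 = linkEnergy (cellWeight X m) τ ψ := by
      rw [← hE, Finset.mul_sum]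
      refine Finset.sum_congr rfl fun u _ => ?_
      simp only [Pi.smul_apply, smul_eq_mul]
      ring
    have hμ0 : 0 ≤ μ := by
      have := hw.linkEnergy_nonneg hcard ψ
      rw [← hE'] at this
      exact nonneg_of_mul_nonneg_left this hpos
    -- Connectedness enters here: an eigenfunction for 0 has energy 0, hence is constant, and being
    -- orthogonal to the constants it would vanish.
    refine hμ0.lt_of_ne fun h0 => ?_
    rw [← h0, zero_mul] at hE'
    obtain ⟨u, hu⟩ := Function.ne_iff.1 hφ0
    have hconst : ∀ v : {v // v ∈ verts (link X τ)}, ψ v.1 = ψ u.1 := fun v =>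
      eq_of_linkEnergy_eq_zero hm hcard hconn hE'.symm v.2 u.2
    simp only [hconst, ← Finset.sum_mul] at hsum
    rcases mul_eq_zero.1 hsum with h1 | h1
    · exact (Finset.sum_pos (fun v _ => ha v) ⟨u, Finset.mem_univ u⟩).ne' h1
    · exact hu h1

/-- Spectral descent: the quadratic forms of all links of simplices with `j` vertices. -/
theorem linkBounds_level (hm : IsWeight X n m) {lam kap : ℝ}
    (h : TwoSidedLocalSpectralExpansion X m n lam kap) {j : ℕ} (hj : j < n) {τ : Finset V}
    (hτ : τ.card = j) :
    LinkBounds (cellWeight X m) τ (level n j lam) (level n j kap) := by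
  have hw := isBalanced_cellWeight hm
  -- Upward induction on the codimension n - 1 - j. The base case is the hypothesis on
  -- one-dimensional links; sets that are not simplices have weight zero and are trivial.
  induction hi : n - 1 - j generalizing j τ with
  | zero =>
    by_cases hX : τ = ∅ ∨ τ ∈ X
    · obtain rfl : j = n - 1 := by omega
      have hcell : τ ∈ cells X (n - 1) := mem_cells.2 ⟨hτ, hX⟩
      rw [level_self, level_self]
      refine linkBounds_of_eigenvalues hm hcell (by omega) (h.connected _ (by omega) _ hcell) ?_
      intro μ φ hφ hμ heig
      refine h.spectrum_subset _ (by omega) τ hcell ⟨?_, hμ.ne'⟩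
      exact (Module.End.hasEigenvalue_of_hasEigenvector
        ⟨Module.End.mem_eigenspace_iff.2 heig, hφ⟩).mem_spectrum
    · exact hw.linkBounds_of_weight_eq_zero (by omega) (if_neg hX) _ _
  | succ i ih =>
    by_cases hX : τ = ∅ ∨ τ ∈ X
    · have hcell : τ ∈ cells X j := mem_cells.2 ⟨hτ, hX⟩
      refine linkBounds_of_eigenvalues hm hcell (by omega) (h.connected _ (by omega) _ hcell) ?_
      intro μ φ hφ hμ heig
      have hlow := h.lower
      have hj1 : j + 1 < n := by omega
      obtain ⟨ψ, rfl⟩ : ∃ ψ : V → ℝ,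
          (fun v : {v // v ∈ verts (link X τ)} => ψ v.1) = φ := exists_extension φ
      rw [level_succ hj1, level_succ hj1]
      refine hw.descend_eigenvalue (τ := τ) (by omega) (level_pos hj1 hlow)
        (level_pos hj1 (hlow.trans_le h.le))
        (fun u hu => ih hj1 (by rw [Finset.card_insert_of_notMem hu, hτ]) (by omega)) hμ
        (φ := ψ) ?_ ?_
      · obtain ⟨u, hu⟩ := Function.ne_iff.1 hφ
        exact Finset.sum_pos' (fun v _ => mul_nonneg (hw.linkVertex_nonneg (by omega) v)
          (sq_nonneg _)) ⟨u.1, Finset.mem_univ _,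
            mul_pos (linkVertex_cellWeight_pos hm (by omega) u.2) (sq_pos_iff.2 hu)⟩
      · intro u
        by_cases hu : u ∈ verts (link X τ)
        · have h1 := linkVertex_mul_upLaplacian hm (τ := τ) (by omega) ψ ⟨u, hu⟩
          rw [heig] at h1
          simp only [Pi.smul_apply, smul_eq_mul] at h1
          linarith
        · have h0 := linkVertex_cellWeight_eq_zero (m := m) hu
          simp [h0, hw.linkEdge_eq_zero (by omega) h0]
    · exact hw.linkBounds_of_weight_eq_zero (by omega) (if_neg hX) _ _

/-- The descended upper bounds are at least `1`. -/
theorem one_le_level (hX : IsPure X n) (hm : IsWeight X n m) {lam kap : ℝ}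
    (h : TwoSidedLocalSpectralExpansion X m n lam kap) {j : ℕ} (hj : j < n) :
    1 ≤ level n j kap := by
  have hw := isBalanced_cellWeight hm
  obtain ⟨t, ht, htc⟩ := hX.1
  -- A face with j + 1 vertices of a top simplex: removing one vertex leaves a simplex with j
  -- vertices whose link contains the removed vertex.
  obtain ⟨s, hst, hs⟩ := Finset.exists_subset_card_eq (s := t) (n := j + 1) (by omega)
  have hsne : s.Nonempty := Finset.card_pos.1 (by omega)
  obtain ⟨u, hu⟩ := hsne
  have hcard : (s.erase u).card = j := by rw [Finset.card_erase_of_mem hu]; omega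
  have hlow := h.lower
  refine hw.one_le_of_linkBounds (τ := s.erase u) (by omega) (level_pos hj hlow).le
    (level_le_level hj hlow h.le) (linkBounds_level hm h hj hcard) (u := u)
    (linkVertex_cellWeight_pos hm (by omega) (mem_verts_link.2 ⟨Finset.notMem_erase u s, ?_⟩))
  rw [Finset.insert_erase hu]
  exact mem_of_subset ht hst ⟨u, hu⟩

end LinksOfComplexes

/-! ### Norms of off-diagonal blocks. -/

section OffDiagonal

/-- An off-diagonal block of a symmetric form whose spectrum lies in `[lo, hi]` has norm at most
`(hi - lo) / 2`. -/
theorem sum_sq_le_of_form_bounds {V : Type*} [Fintype V] [DecidableEq V] {a : V → ℝ}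
    {k : V → V → ℝ} (hk : ∀ u v, k u v = k v u)
    {lo hi : ℝ} (hle : lo ≤ hi)
    (hb : ∀ φ : V → ℝ, lo * ∑ u, a u * φ u ^ 2 ≤ ∑ u, ∑ v, k u v * φ u * φ v ∧
      ∑ u, ∑ v, k u v * φ u * φ v ≤ hi * ∑ u, a u * φ u ^ 2)
    {A B : Finset V} (hAB : Disjoint A B) {f g : V → ℝ}
    (hg : ∀ v ∈ B, a v * g v = ∑ u ∈ A, k u v * f u) :
    ∑ v ∈ B, a v * g v ^ 2 ≤ ((hi - lo) / 2) ^ 2 * ∑ u ∈ A, a u * f u ^ 2 := by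
  set f' : V → ℝ := fun u => if u ∈ A then f u else 0 with hf'
  set g' : V → ℝ := fun u => if u ∈ B then g u else 0 with hg'
  set Nf := ∑ u ∈ A, a u * f u ^ 2 with hNf
  set Ng := ∑ v ∈ B, a v * g v ^ 2 with hNg
  have hfg : ∀ u, f' u * g' u = 0 := by
    intro u
    simp only [hf', hg']
    split_ifs with h1 h2
    · exact absurd h2 (Finset.disjoint_left.1 hAB h1)
    all_goals simp
  have hf1 : ∑ u, a u * f' u ^ 2 = Nf := by
    simp [hNf, hf', ite_pow]
  have hg1 : ∑ u, a u * g' u ^ 2 = Ng := by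
    simp [hNg, hg', ite_pow]
  have hnorm : ∀ s : ℝ, ∑ u, a u * (f' u + s * g' u) ^ 2 = Nf + s ^ 2 * Ng := by
    intro s
    rw [← hf1, ← hg1, Finset.mul_sum, ← Finset.sum_add_distrib]
    refine Finset.sum_congr rfl fun u _ => ?_
    linear_combination 2 * s * a u * hfg u
  -- As g is the image of f on B, the cross term of the form is the squared norm of g.
  have hcross : ∑ u, ∑ v, k u v * f' u * g' v = Ng := by
    rw [Finset.sum_comm, hNg]
    have : ∀ v, ∑ u, k u v * f' u * g' v = if v ∈ B then a v * g v ^ 2 else 0 := by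
      intro v
      rw [← Finset.sum_mul]
      have h1 : ∑ u, k u v * f' u = ∑ u ∈ A, k u v * f u := by simp [hf']
      rw [h1]
      simp only [hg']
      split_ifs with hv
      · rw [← hg v hv]; ring
      · simp
    simp only [this]
    simp
  have hcross' : ∑ u, ∑ v, k u v * g' u * f' v = Ng := by
    rw [← hcross, Finset.sum_comm]
    exact Finset.sum_congr rfl fun u _ => Finset.sum_congr rfl fun v _ => by rw [hk]; ring
  have hform : ∀ s : ℝ, ∑ u, ∑ v, k u v * (f' u + s * g' u) * (f' v + s * g' v) =
      ∑ u, ∑ v, k u v * f' u * f' v + s ^ 2 * ∑ u, ∑ v, k u v * g' u * g' v + 2 * s * Ng := by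
    intro s
    have : 2 * s * Ng = s * ∑ u, ∑ v, k u v * f' u * g' v +
        s * ∑ u, ∑ v, k u v * g' u * f' v := by rw [hcross, hcross']; ring
    rw [this]
    simp only [Finset.mul_sum, ← Finset.sum_add_distrib]
    exact Finset.sum_congr rfl fun u _ => Finset.sum_congr rfl fun v _ => by ring
  -- Subtract the lower bound at f' - s g' from the upper bound at f' + s g': the diagonal terms
  -- cancel, and the two norms agree because the supports are disjoint.
  have key : ∀ s : ℝ, 4 * s * Ng ≤ (hi - lo) * (Nf + s ^ 2 * Ng) := by
    intro s
    have h1 := (hb fun u => f' u + s * g' u).2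
    have h2 := (hb fun u => f' u + (-s) * g' u).1
    rw [hnorm, hform] at h1 h2
    nlinarith
  -- The best parameter is s = 2 / (hi - lo). If hi = lo, then s = 1 already forces the norm of g to
  -- be 0.
  rcases hle.eq_or_lt with h0 | h0
  · have := key 1
    rw [h0, sub_self] at this ⊢
    linarith
  · have hD : 0 < hi - lo := sub_pos.2 h0
    have h1 := key (2 / (hi - lo))
    have h2 : 4 * (2 / (hi - lo)) * Ng * (hi - lo) = 8 * Ng := by field_simp; ring
    have h3 : (hi - lo) * (Nf + (2 / (hi - lo)) ^ 2 * Ng) * (hi - lo) =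
        (hi - lo) ^ 2 * Nf + 4 * Ng := by field_simp; ring
    have h4 := mul_le_mul_of_nonneg_right h1 hD.le
    rw [h2, h3] at h4
    nlinarith

end OffDiagonal

/-! ### Block norms for the three operators on a link. -/

section LinkForms

variable {V : Type*} [Fintype V] [DecidableEq V] {w : Finset V → ℝ} {n : ℕ} {τ : Finset V}

theorem sum_rankOne (w : Finset V → ℝ) (τ : Finset V) (r : ℝ) (φ : V → ℝ) :
    ∑ u, ∑ v, r * (linkVertex w τ u * linkVertex w τ v / w τ) * φ u * φ v =
      r * (∑ u, linkVertex w τ u * φ u ^ 2 - linkVariance w τ φ) := by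
  rw [linkVariance, sub_sub_cancel, sq, Finset.sum_mul_sum, Finset.sum_div, Finset.mul_sum]
  refine Finset.sum_congr rfl fun u _ => ?_
  rw [Finset.sum_div, Finset.mul_sum]
  exact Finset.sum_congr rfl fun v _ => by ring

theorem sum_linkEdge_form (w : Finset V → ℝ) (τ : Finset V) (φ : V → ℝ) :
    ∑ u, ∑ v, linkEdge w τ u v * φ u * φ v =
      ∑ u, linkVertex w τ u * φ u ^ 2 - linkEnergy w τ φ := by
  rw [linkEnergy, sub_sub_cancel]

variable (hw : IsBalanced w n) (hτ : τ.card + 1 ≤ n) {lo hi : ℝ} {A B : Finset V}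
  (hAB : Disjoint A B) {f g : V → ℝ}
include hw hτ hAB

/-- The adjacency form 1 - Δ has spectrum in [1 - hi, 1], an interval of width hi. -/
theorem IsBalanced.sum_sq_le_edge (hhi : 0 ≤ hi) (h : LinkBounds w τ lo hi)
    (hg : ∀ v ∈ B, linkVertex w τ v * g v = ∑ u ∈ A, linkEdge w τ u v * f u) :
    ∑ v ∈ B, linkVertex w τ v * g v ^ 2 ≤
      (hi / 2) ^ 2 * ∑ u ∈ A, linkVertex w τ u * f u ^ 2 := by
  have := sum_sq_le_of_form_bounds (lo := 1 - hi) (hi := 1) (linkEdge_comm w τ) (by linarith)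
    (fun φ => ?_) hAB hg
  · simpa using this
  · rw [sum_linkEdge_form]
    have h1 := hw.linkEnergy_nonneg hτ φ
    have h2 := (h φ).2
    have h3 := mul_le_mul_of_nonneg_left (hw.linkVariance_le (τ := τ) (by omega) φ) hhi
    constructor <;> linarith

/-- The kernel is r times the projection to the constants, with spectrum in [0, r]. -/
theorem IsBalanced.sum_sq_le_rankOne {r : ℝ} (hr : 0 ≤ r)
    (hg : ∀ v ∈ B, linkVertex w τ v * g v =
      ∑ u ∈ A, r * (linkVertex w τ u * linkVertex w τ v / w τ) * f u) :
    ∑ v ∈ B, linkVertex w τ v * g v ^ 2 ≤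
      (r / 2) ^ 2 * ∑ u ∈ A, linkVertex w τ u * f u ^ 2 := by
  have := sum_sq_le_of_form_bounds (lo := 0) (hi := r) (a := linkVertex w τ)
    (fun u v => by ring) hr (fun φ => ?_) hAB hg
  · simpa using this
  · rw [sum_rankOne]
    have h1 := mul_nonneg hr (hw.linkVariance_nonneg (τ := τ) (by omega) φ)
    have h2 := mul_nonneg hr (sub_nonneg.2 (hw.linkVariance_le (τ := τ) (by omega) φ))
    constructor <;> linarith

/-- Subtracting the midpoint times the projection moves the eigenvalue 1 of the constants to 1 - (lo
+ hi) / 2, inside the interval [1 - hi, 1 - lo] that holds the rest of the spectrum. -/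
theorem IsBalanced.sum_sq_le_sub (hle : lo ≤ hi) (h : LinkBounds w τ lo hi)
    (hg : ∀ v ∈ B, linkVertex w τ v * g v = ∑ u ∈ A, (linkEdge w τ u v -
      (lo + hi) / 2 * (linkVertex w τ u * linkVertex w τ v / w τ)) * f u) :
    ∑ v ∈ B, linkVertex w τ v * g v ^ 2 ≤
      ((hi - lo) / 2) ^ 2 * ∑ u ∈ A, linkVertex w τ u * f u ^ 2 := by
  have := sum_sq_le_of_form_bounds (lo := 1 - hi) (hi := 1 - lo) (a := linkVertex w τ)
    (fun u v => by rw [linkEdge_comm]; ring) (by linarith) (fun φ => ?_) hAB hg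
  · convert this using 3
    ring
  · simp only [sub_mul, Finset.sum_sub_distrib]
    rw [sum_linkEdge_form, sum_rankOne]
    obtain ⟨h1, h2⟩ := h φ
    have h3 := hw.linkVariance_le (τ := τ) (by omega) φ
    constructor <;> nlinarith

end LinkForms

/-! ### Lists with prescribed colours. -/

section ListSums

variable {V : Type*} [DecidableEq V]

/-- The lists `[u₁, u₂, …]` with `u₁ ∈ U₁`, `u₂ ∈ U₂`, … for `L = [U₁, U₂, …]`. -/
def listPi : List (Finset V) → Finset (List V)
  | [] => {[]}
  | A :: L => (A ×ˢ listPi L).image fun p => p.1 :: p.2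

@[simp]
theorem listPi_nil : listPi ([] : List (Finset V)) = {[]} := rfl

theorem mem_listPi {L : List (Finset V)} {t : List V} :
    t ∈ listPi L ↔ List.Forall₂ (· ∈ ·) t L := by
  induction L generalizing t with
  | nil => simp
  | cons A L ih =>
    simp only [listPi, Finset.mem_image, Finset.mem_product, Prod.exists, ih,
      List.forall₂_cons_right_iff]
    constructor
    · rintro ⟨u, t, ⟨hu, ht⟩, rfl⟩
      exact ⟨u, t, hu, ht, rfl⟩
    · rintro ⟨u, t, hu, ht, rfl⟩
      exact ⟨u, t, ⟨hu, ht⟩, rfl⟩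

theorem sum_listPi_cons (A : Finset V) (L : List (Finset V)) (F : List V → ℝ) :
    ∑ t ∈ listPi (A :: L), F t = ∑ t ∈ listPi L, ∑ u ∈ A, F (u :: t) := by
  rw [listPi, Finset.sum_image, Finset.sum_product_right]
  rintro ⟨u, s⟩ _ ⟨v, t⟩ _ h
  simpa using h

theorem sum_listPi_concat (L : List (Finset V)) (B : Finset V) (F : List V → ℝ) :
    ∑ t ∈ listPi (L ++ [B]), F t = ∑ t ∈ listPi L, ∑ v ∈ B, F (t ++ [v]) := by
  induction L generalizing F with
  | nil => simp [sum_listPi_cons]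
  | cons A L ih =>
    rw [List.cons_append, sum_listPi_cons, ih, sum_listPi_cons]
    refine Finset.sum_congr rfl fun t _ => ?_
    rw [Finset.sum_comm]
    simp

/-- The list `[U i, U (i + 1), …, U (i + c - 1)]`. -/
def window (U : ℕ → Finset V) (i c : ℕ) : List (Finset V) := (List.range' i c).map U

omit [DecidableEq V] in
theorem window_zero (U : ℕ → Finset V) (i : ℕ) : window U i 0 = [] := rfl

omit [DecidableEq V] in
theorem window_succ (U : ℕ → Finset V) (i c : ℕ) :
    window U i (c + 1) = U i :: window U (i + 1) c := rfl

omit [DecidableEq V] in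
theorem window_succ' (U : ℕ → Finset V) (i c : ℕ) :
    window U i (c + 1) = window U i c ++ [U (i + c)] := by
  simp [window, List.range'_1_concat]

variable {U : ℕ → Finset V} (hU : ∀ i j, i ≠ j → Disjoint (U i) (U j))
include hU

theorem notMem_of_mem_window {i c k : ℕ} (hk : k < i ∨ i + c ≤ k) {u : V} (hu : u ∈ U k)
    {t : List V} (ht : t ∈ listPi (window U i c)) : u ∉ t.toFinset := by
  induction c generalizing i t with
  | zero =>
    rw [window_zero, listPi_nil, Finset.mem_singleton] at ht
    simp [ht]
  | succ c ih =>
    rw [window_succ, mem_listPi, List.forall₂_cons_right_iff] at ht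
    obtain ⟨v, s, hv, hs, rfl⟩ := ht
    have h1 := ih (i := i + 1) (by omega) (mem_listPi.2 hs)
    have h2 : u ≠ v := fun h =>
      Finset.disjoint_left.1 (hU k i (by omega)) hu (h ▸ hv)
    simp only [List.mem_toFinset] at h1
    simp [h1, h2]

/-- Distinct positions have disjoint colours, so no vertex repeats. -/
theorem card_of_mem_window {i c : ℕ} {t : List V} (ht : t ∈ listPi (window U i c)) :
    t.toFinset.card = c := by
  induction c generalizing i t with
  | zero =>
    rw [window_zero, listPi_nil, Finset.mem_singleton] at ht
    simp [ht]
  | succ c ih =>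
    rw [window_succ, mem_listPi, List.forall₂_cons_right_iff] at ht
    obtain ⟨v, s, hv, hs, rfl⟩ := ht
    have hs := mem_listPi.2 hs
    rw [List.toFinset_cons, Finset.card_insert_of_notMem
      (notMem_of_mem_window hU (Or.inl (Nat.lt_succ_self i)) hv hs), ih hs]

end ListSums

/-! ### Weighted ℓ²-norms on lists. -/

section WeightedNorm

variable {V : Type*} [DecidableEq V]

/-- The weighted `ℓ²`-norm of `F` on the lists in `listPi L`. -/
noncomputable def listNorm (w : Finset V → ℝ) (L : List (Finset V)) (F : List V → ℝ) : ℝ :=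
  √(∑ t ∈ listPi L, w t.toFinset * F t ^ 2)

theorem listNorm_nonneg (w : Finset V → ℝ) (L : List (Finset V)) (F : List V → ℝ) :
    0 ≤ listNorm w L F :=
  Real.sqrt_nonneg _

theorem listNorm_congr {w : Finset V → ℝ} {L : List (Finset V)} {F G : List V → ℝ}
    (h : ∀ t ∈ listPi L, F t = G t) : listNorm w L F = listNorm w L G := by
  unfold listNorm
  rw [Finset.sum_congr rfl fun t ht => by rw [h t ht]]

theorem abs_sum_mul_le {ι : Type*} (s : Finset ι) {a : ι → ℝ} (ha : ∀ t ∈ s, 0 ≤ a t)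
    (F G : ι → ℝ) :
    |∑ t ∈ s, a t * (F t * G t)| ≤ √(∑ t ∈ s, a t * F t ^ 2) * √(∑ t ∈ s, a t * G t ^ 2) := by
  have h := Finset.sum_sq_le_sum_mul_sum_of_sq_le_mul s
    (r := fun t => a t * (F t * G t)) (f := fun t => a t * F t ^ 2) (g := fun t => a t * G t ^ 2)
    (fun t ht => mul_nonneg (ha t ht) (sq_nonneg _))
    (fun t ht => mul_nonneg (ha t ht) (sq_nonneg _)) (fun t _ => le_of_eq (by ring))
  rw [← Real.sqrt_mul (Finset.sum_nonneg fun t ht => mul_nonneg (ha t ht) (sq_nonneg _))]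
  exact Real.abs_le_sqrt h

variable {w : Finset V → ℝ} {L : List (Finset V)} (hw : ∀ t ∈ listPi L, 0 ≤ w t.toFinset)
include hw

theorem sq_listNorm (F : List V → ℝ) :
    listNorm w L F ^ 2 = ∑ t ∈ listPi L, w t.toFinset * F t ^ 2 :=
  Real.sq_sqrt (Finset.sum_nonneg fun t ht => mul_nonneg (hw t ht) (sq_nonneg _))

theorem listNorm_add_le (F G : List V → ℝ) :
    listNorm w L (fun t => F t + G t) ≤ listNorm w L F + listNorm w L G := by
  refine Real.sqrt_le_iff.2 ⟨add_nonneg (listNorm_nonneg _ _ _) (listNorm_nonneg _ _ _), ?_⟩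
  have h1 := (le_abs_self _).trans (abs_sum_mul_le (listPi L) hw F G)
  have h2 : ∑ t ∈ listPi L, w t.toFinset * (F t + G t) ^ 2 =
      ∑ t ∈ listPi L, w t.toFinset * F t ^ 2 + ∑ t ∈ listPi L, w t.toFinset * G t ^ 2 +
        2 * ∑ t ∈ listPi L, w t.toFinset * (F t * G t) := by
    simp only [Finset.mul_sum, ← Finset.sum_add_distrib]
    exact Finset.sum_congr rfl fun t _ => by ring
  have h3 : (listNorm w L F + listNorm w L G) ^ 2 =
      listNorm w L F ^ 2 + listNorm w L G ^ 2 + 2 * (listNorm w L F * listNorm w L G) := by ring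
  rw [h2, h3, sq_listNorm hw, sq_listNorm hw]
  unfold listNorm
  linarith

end WeightedNorm

/-! ### Walks on lists and the comparison of consecutive lengths. -/

section Paths

variable {V : Type*} [DecidableEq V]

/-- The total weight, under the walk whose steps add a vertex at the end of a list and drop the
first one, of the paths of length `k` that end in a given list, with the added vertices' colours
prescribed by `U`. -/
noncomputable def pathSum (w : Finset V → ℝ) (U : ℕ → Finset V) : ℕ → List V → ℝ
  | 0, _ => 1
  | k + 1, t => ∑ u ∈ U k, w (u :: t).toFinset / w t.toFinset * pathSum w U k (u :: t).dropLast

/-- The total weight of the walks through the colours `U 0, …, U l` whose positions are lists of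
length `c`. -/
noncomputable def walkWeight (w : Finset V → ℝ) (U : ℕ → Finset V) (l c : ℕ) : ℝ :=
  ∑ t ∈ listPi (window U (l + 1 - c) c), w t.toFinset * pathSum w U (l + 1 - c) t

theorem toFinset_concat (y : List V) (v : V) : (y ++ [v]).toFinset = insert v y.toFinset := by
  ext x
  simp

/-- Every position is the empty list, so the l + 1 steps are independent factors; the weight of the
starting position cancels one of the l + 1 denominators. -/
theorem walkWeight_zero (w : Finset V → ℝ) (U : ℕ → Finset V) (l : ℕ) (h0 : w ∅ ≠ 0) :
    walkWeight w U l 0 = (∏ i ∈ Finset.range (l + 1), ∑ u ∈ U i, w {u}) / w ∅ ^ l := by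
  have h : ∀ k, pathSum w U k [] = ∏ i ∈ Finset.range k, ((∑ u ∈ U i, w {u}) / w ∅) := by
    intro k
    induction k with
    | zero => simp [pathSum]
    | succ k ih =>
      rw [Finset.prod_range_succ, ← ih, pathSum, mul_comm, Finset.sum_div, Finset.sum_mul]
      simp
  simp only [walkWeight, window_zero, listPi_nil, Finset.sum_singleton, Nat.sub_zero, h,
    Finset.prod_div_distrib, Finset.prod_const, Finset.card_range, List.toFinset_nil]
  field_simp
  ring

variable [Fintype V] {w : Finset V → ℝ} {n : ℕ} (hw : IsBalanced w n) {U : ℕ → Finset V}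
  (hU : ∀ i j, i ≠ j → Disjoint (U i) (U j))

include hw in
-- A vertex of weight zero has only edges of weight zero, so division by zero does no harm.
theorem linkVertex_mul_div {τ : Finset V} (hτ : τ.card + 1 ≤ n) (u v : V) :
    linkVertex w τ v * (linkEdge w τ u v / linkVertex w τ v) = linkEdge w τ u v := by
  by_cases h0 : linkVertex w τ v = 0
  · rw [linkEdge_comm, hw.linkEdge_eq_zero hτ h0]; simp
  · field_simp

omit [Fintype V] in
include hU in
theorem linkVertex_cons {i j k : ℕ} (hk : k < i ∨ i + j ≤ k) {u : V} (hu : u ∈ U k)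
    {y : List V} (hy : y ∈ listPi (window U i j)) :
    w (u :: y).toFinset = linkVertex w y.toFinset u := by
  rw [linkVertex, if_neg (notMem_of_mem_window hU hk hu hy), List.toFinset_cons]

omit [Fintype V] in
include hU in
theorem linkVertex_concat {i j k : ℕ} (hk : k < i ∨ i + j ≤ k) {u : V} (hu : u ∈ U k)
    {y : List V} (hy : y ∈ listPi (window U i j)) :
    w (y ++ [u]).toFinset = linkVertex w y.toFinset u := by
  rw [linkVertex, if_neg (notMem_of_mem_window hU hk hu hy), toFinset_concat]

omit [Fintype V] in
include hU in
theorem linkEdge_cons_concat {i j : ℕ} {u v : V} (hu : u ∈ U i) (hv : v ∈ U (i + 1 + j))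
    {y : List V} (hy : y ∈ listPi (window U (i + 1) j)) :
    w (u :: (y ++ [v])).toFinset = linkEdge w y.toFinset u v := by
  have h1 := notMem_of_mem_window hU (Or.inl (Nat.lt_succ_self i)) hu hy
  have h2 := notMem_of_mem_window hU (Or.inr le_rfl) hv hy
  have h3 : u ≠ v := fun h => Finset.disjoint_left.1 (hU i (i + 1 + j) (by omega)) hu (h ▸ hv)
  rw [linkEdge_eq, if_neg (by tauto), List.toFinset_cons, toFinset_concat]

omit [Fintype V] in
include hU in
/-- A step of the walk on lists of length `j`, lifted to lists of length `j + 1`. -/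
theorem linkVertex_mul_pathSum_dropLast {i j : ℕ} {y : List V}
    (hy : y ∈ listPi (window U (i + 1) j)) (r : ℝ) (v : V) :
    linkVertex w y.toFinset v * (r ^ (i + 1) * pathSum w U (i + 1) (y ++ [v]).dropLast) =
      ∑ u ∈ U i, r * (linkVertex w y.toFinset u * linkVertex w y.toFinset v / w y.toFinset) *
        (r ^ i * pathSum w U i (u :: y).dropLast) := by
  rw [List.dropLast_concat, pathSum, Finset.mul_sum, Finset.mul_sum]
  refine Finset.sum_congr rfl fun u hu => ?_
  rw [linkVertex_cons (w := w) hU (Or.inl i.lt_succ_self) hu hy]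
  ring

include hw hU

theorem weight_nonneg_of_mem_window {i c : ℕ} (hc : c ≤ n + 1) :
    ∀ t ∈ listPi (window U i c), 0 ≤ w t.toFinset := fun t ht =>
  hw.nonneg _ (by rw [card_of_mem_window hU ht]; exact hc)

theorem sum_window_succ_le (i : ℕ) {c : ℕ} (hc : c ≤ n) :
    ∑ t ∈ listPi (window U i (c + 1)), w t.toFinset ≤
      ∑ t ∈ listPi (window U i c), w t.toFinset := by
  rw [window_succ', sum_listPi_concat]
  refine Finset.sum_le_sum fun y hy => ?_
  have hcard := card_of_mem_window hU hy
  rw [← hw.sum_eq _ (by omega), Finset.sum_congr rfl fun v hv =>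
    linkVertex_concat hU (Or.inr le_rfl) hv hy]
  exact Finset.sum_le_sum_of_subset_of_nonneg (Finset.subset_univ _) fun v _ _ =>
    hw.linkVertex_nonneg (by omega) v

theorem sum_window_succ_le' (i : ℕ) {c : ℕ} (hc : c ≤ n) :
    ∑ t ∈ listPi (window U i (c + 1)), w t.toFinset ≤
      ∑ t ∈ listPi (window U (i + 1) c), w t.toFinset := by
  rw [window_succ, sum_listPi_cons]
  refine Finset.sum_le_sum fun y hy => ?_
  have hcard := card_of_mem_window hU hy
  rw [← hw.sum_eq _ (by omega), Finset.sum_congr rfl fun v hv =>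
    linkVertex_cons hU (Or.inl (Nat.lt_succ_self i)) hv hy]
  exact Finset.sum_le_sum_of_subset_of_nonneg (Finset.subset_univ _) fun v _ _ =>
    hw.linkVertex_nonneg (by omega) v

theorem sum_window_le_first (i : ℕ) {j : ℕ} (hj : j ≤ n) :
    ∑ t ∈ listPi (window U i (j + 1)), w t.toFinset ≤ ∑ u ∈ U i, w {u} := by
  induction j with
  | zero => simp [window_succ, window_zero, sum_listPi_cons]
  | succ j ih => exact (sum_window_succ_le hw hU i (by omega)).trans (ih (by omega))

theorem sum_window_le_last (i : ℕ) {j : ℕ} (hj : j ≤ n) :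
    ∑ t ∈ listPi (window U i (j + 1)), w t.toFinset ≤ ∑ u ∈ U (i + j), w {u} := by
  induction j generalizing i with
  | zero => simp [window_succ, window_zero, sum_listPi_cons]
  | succ j ih =>
    rw [show i + (j + 1) = i + 1 + j by ring]
    exact (sum_window_succ_le' hw hU i (by omega)).trans (ih (i + 1) (by omega))

/-- Local norm bounds on the links give a norm bound for a step of the walk. -/
theorem listNorm_step_le {i j : ℕ} (hj : j + 1 ≤ n) {C : ℝ} (hC : 0 ≤ C) {F G : List V → ℝ}
    (h : ∀ y ∈ listPi (window U (i + 1) j),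
      ∑ v ∈ U (i + 1 + j), linkVertex w y.toFinset v * G (y ++ [v]) ^ 2 ≤
        C ^ 2 * ∑ u ∈ U i, linkVertex w y.toFinset u * F (u :: y) ^ 2) :
    listNorm w (window U (i + 1) (j + 1)) G ≤ C * listNorm w (window U i (j + 1)) F := by
  refine (sq_le_sq₀ (listNorm_nonneg _ _ _) (mul_nonneg hC (listNorm_nonneg _ _ _))).1 ?_
  -- Both norms are sliced along the shared middle part y of u :: y and y ++ [v], where the local
  -- bound applies.
  rw [mul_pow, sq_listNorm (weight_nonneg_of_mem_window hw hU (by omega)),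
    sq_listNorm (weight_nonneg_of_mem_window hw hU (by omega)), window_succ', window_succ,
    sum_listPi_concat, sum_listPi_cons, Finset.mul_sum]
  refine Finset.sum_le_sum fun y hy => ?_
  rw [Finset.sum_congr rfl fun v hv => by rw [linkVertex_concat (w := w) hU (Or.inr le_rfl) hv hy]]
  refine (h y hy).trans_eq ?_
  rw [Finset.sum_congr rfl fun u hu => by rw [← linkVertex_cons hU (Or.inl i.lt_succ_self) hu hy]]

/-- A step of the walk on lists of length `j + 1`. -/
theorem linkVertex_mul_pathSum_succ {i j : ℕ} (hj : j + 1 ≤ n) {y : List V}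
    (hy : y ∈ listPi (window U (i + 1) j)) {v : V} (hv : v ∈ U (i + 1 + j)) :
    linkVertex w y.toFinset v * pathSum w U (i + 1) (y ++ [v]) =
      ∑ u ∈ U i, linkEdge w y.toFinset u v * pathSum w U i (u :: y) := by
  have hcard := card_of_mem_window hU hy
  rw [pathSum, Finset.mul_sum]
  refine Finset.sum_congr rfl fun u hu => ?_
  rw [linkEdge_cons_concat (w := w) hU hu hv hy, linkVertex_concat (w := w) hU (Or.inr le_rfl) hv hy,
    ← List.cons_append, List.dropLast_concat, ← mul_assoc,
    linkVertex_mul_div hw (by omega)]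

variable {lo hi : ℝ} {j : ℕ} (hj : j + 1 ≤ n) (hlo : 0 ≤ lo) (hle : lo ≤ hi)
  (h : ∀ τ : Finset V, τ.card = j → LinkBounds w τ lo hi)
include hj hlo hle h

/-- Each step joins disjoint colours, hence gains the block norm hi / 2 of the adjacency operator.
-/
theorem listNorm_pathSum_le (i : ℕ) :
    listNorm w (window U i (j + 1)) (pathSum w U i) ≤
      (hi / 2) ^ i * listNorm w (window U 0 (j + 1)) fun _ => 1 := by
  have hhi : 0 ≤ hi := hlo.trans hle
  induction i with
  | zero =>
    rw [pow_zero, one_mul, listNorm_congr fun t _ => pathSum.eq_1 w U t]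
  | succ i ih =>
    rw [pow_succ', mul_assoc]
    refine (listNorm_step_le hw hU hj (by positivity) (F := pathSum w U i) fun y hy => ?_).trans
      (mul_le_mul_of_nonneg_left ih (by positivity))
    have hcard := card_of_mem_window hU hy
    exact hw.sum_sq_le_edge (by omega) (hU _ _ (by omega)) hhi (h _ hcard)
      (f := fun u => pathSum w U i (u :: y)) (g := fun v => pathSum w U (i + 1) (y ++ [v]))
      fun v hv => linkVertex_mul_pathSum_succ hw hU hj hy hv

/-- Replacing the walk on lists of length `j + 1` by the walk on lists of length `j`. -/
theorem listNorm_pathSum_sub_le (i : ℕ) :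
    listNorm w (window U i (j + 1))
        (fun t => pathSum w U i t - ((lo + hi) / 2) ^ i * pathSum w U i t.dropLast) ≤
      i * (hi / 2) ^ (i - 1) * ((hi - lo) / 2) *
        listNorm w (window U 0 (j + 1)) fun _ => 1 := by
  have hhi : 0 ≤ hi := hlo.trans hle
  set r := (lo + hi) / 2 with hr
  have hr0 : 0 ≤ r := by rw [hr]; linarith
  set S := listNorm w (window U 0 (j + 1)) fun _ => 1 with hS
  have hS0 : 0 ≤ S := listNorm_nonneg _ _ _
  induction i with
  | zero => simp [pathSum, listNorm]
  | succ i ih =>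
    set F := pathSum w U i with hF
    set G := fun t : List V => r ^ i * pathSum w U i t.dropLast with hG
    -- The hybrid walk: its newest step uses the rank-one kernel, all earlier ones the adjacency
    -- kernel. The difference to the full walk costs (hi - lo) / 2; the difference to the short walk
    -- is a rank-one step applied to the inductive error.
    set Q := fun t : List V => ∑ u ∈ U i, r * (w (u :: t.dropLast).toFinset / w t.dropLast.toFinset) *
      F (u :: t.dropLast) with hQ
    have hQ' : ∀ y ∈ listPi (window U (i + 1) j), ∀ v, linkVertex w y.toFinset v * Q (y ++ [v]) =
        ∑ u ∈ U i, r * (linkVertex w y.toFinset u * linkVertex w y.toFinset v / w y.toFinset) *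
          F (u :: y) := by
      intro y hy v
      simp only [hQ, List.dropLast_concat, Finset.mul_sum]
      refine Finset.sum_congr rfl fun u hu => ?_
      rw [linkVertex_cons (w := w) hU (Or.inl i.lt_succ_self) hu hy]
      ring
    have h1 : listNorm w (window U (i + 1) (j + 1)) (fun t => pathSum w U (i + 1) t - Q t) ≤
        (hi - lo) / 2 * listNorm w (window U i (j + 1)) F := by
      refine listNorm_step_le hw hU hj (by linarith) fun y hy => ?_
      have hcard := card_of_mem_window hU hy
      refine hw.sum_sq_le_sub (by omega) (hU _ _ (by omega)) hle (h _ hcard)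
        (f := fun u => F (u :: y)) (g := fun v => pathSum w U (i + 1) (y ++ [v]) - Q (y ++ [v]))
        fun v hv => ?_
      rw [mul_sub, hQ' y hy, linkVertex_mul_pathSum_succ hw hU hj hy hv, ← Finset.sum_sub_distrib]
      exact Finset.sum_congr rfl fun u _ => by rw [sub_mul]
    have h2 : listNorm w (window U (i + 1) (j + 1))
        (fun t => Q t - r ^ (i + 1) * pathSum w U (i + 1) t.dropLast) ≤
        r / 2 * listNorm w (window U i (j + 1)) (fun t => F t - G t) := by
      refine listNorm_step_le hw hU hj (by linarith) fun y hy => ?_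
      have hcard := card_of_mem_window hU hy
      refine hw.sum_sq_le_rankOne (by omega) (hU _ _ (by omega)) hr0
        (f := fun u => F (u :: y) - G (u :: y))
        (g := fun v => Q (y ++ [v]) - r ^ (i + 1) * pathSum w U (i + 1) (y ++ [v]).dropLast)
        fun v hv => ?_
      rw [mul_sub, hQ' y hy, linkVertex_mul_pathSum_dropLast hU hy, ← Finset.sum_sub_distrib]
      exact Finset.sum_congr rfl fun u _ => by rw [mul_sub]
    have h3 := listNorm_add_le (weight_nonneg_of_mem_window hw hU (i := i + 1) (c := j + 1)
      (by omega)) (fun t => pathSum w U (i + 1) t - Q t)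
      (fun t => Q t - r ^ (i + 1) * pathSum w U (i + 1) t.dropLast)
    simp only [sub_add_sub_cancel] at h3
    have h4 := listNorm_pathSum_le hw hU hj hlo hle h i
    have h5 : r / 2 * listNorm w (window U i (j + 1)) (fun t => F t - G t) ≤
        hi / 2 * (i * (hi / 2) ^ (i - 1) * ((hi - lo) / 2) * S) :=
      mul_le_mul (by rw [hr]; linarith) ih (listNorm_nonneg _ _ _) (by positivity)
    have h6 : hi / 2 * (i * (hi / 2) ^ (i - 1) * ((hi - lo) / 2) * S) =
        i * (hi / 2) ^ i * ((hi - lo) / 2) * S := by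
      -- For i = 0 the exponent i - 1 is truncated, but the factor i annihilates both sides.
      rcases Nat.eq_zero_or_pos i with h0 | h0
      · simp [h0]
      · rw [← Nat.sub_add_cancel h0, Nat.add_sub_cancel, pow_succ]; ring
    have h7 := mul_le_mul_of_nonneg_left h4 (by linarith : 0 ≤ (hi - lo) / 2)
    calc _ ≤ _ := h3
      _ ≤ (hi - lo) / 2 * ((hi / 2) ^ i * S) + i * (hi / 2) ^ i * ((hi - lo) / 2) * S := by
        rw [← h6]
        exact add_le_add (h1.trans h7) (h2.trans h5)
      _ = _ := by
        rw [Nat.add_sub_cancel]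
        push_cast
        ring

end Paths

/-! ### Comparison of consecutive walk weights. -/

section WalkWeights

variable {V : Type*} [Fintype V] [DecidableEq V] {w : Finset V → ℝ} {n : ℕ}
  (hw : IsBalanced w n) {U : ℕ → Finset V} (hU : ∀ i j, i ≠ j → Disjoint (U i) (U j))
include hw hU

/-- A walk on lists of length `j` in terms of lists of length `j + 1`. -/
theorem walkWeight_eq_sum_dropLast {l j : ℕ} (hln : l ≤ n) (hj : j ≤ l) :
    walkWeight w U l j = ∑ x ∈ listPi (window U (l - j) (j + 1)),
      w x.toFinset * pathSum w U (l - j) x.dropLast := by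
  rw [walkWeight, show l + 1 - j = l - j + 1 by omega, window_succ, sum_listPi_cons]
  refine Finset.sum_congr rfl fun y hy => ?_
  have hcard := card_of_mem_window hU hy
  rw [pathSum, Finset.mul_sum]
  refine Finset.sum_congr rfl fun u hu => ?_
  rw [← mul_assoc]
  congr 1
  by_cases h0 : w y.toFinset = 0
  · rw [linkVertex_cons (w := w) hU (Or.inl (Nat.lt_succ_self _)) hu hy,
      hw.eq_zero_of_weight_eq_zero (by omega) h0, zero_div, mul_zero]
  · field_simp

/-- With positions of length l there is one step, and it cancels the weight of the final position.
-/
theorem walkWeight_self {l : ℕ} (hln : l ≤ n) :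
    walkWeight w U l l = ∑ x ∈ listPi (window U 0 (l + 1)), w x.toFinset := by
  simp [walkWeight_eq_sum_dropLast hw hU hln le_rfl, pathSum]

/-- Read on lists of length j + 1, the difference is a pairing with the constant 1. Cauchy–Schwarz
leaves the norm of 1 on the last window, at most √m(U_l), and the walk comparison brings in the norm
of 1 on the first window, at most √m(U_0). -/
theorem abs_walkWeight_sub_le {l j : ℕ} (hln : l ≤ n) (hj : j < l) {lo hi : ℝ} (hlo : 0 ≤ lo)
    (hle : lo ≤ hi) (h : ∀ τ : Finset V, τ.card = j → LinkBounds w τ lo hi) :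
    |walkWeight w U l (j + 1) - ((lo + hi) / 2) ^ (l - j) * walkWeight w U l j| ≤
      (l - j : ℕ) * (hi / 2) ^ (l - j - 1) * ((hi - lo) / 2) *
        √((∑ u ∈ U 0, w {u}) * ∑ u ∈ U l, w {u}) := by
  have hhi : 0 ≤ hi := hlo.trans hle
  have h1 : walkWeight w U l (j + 1) - ((lo + hi) / 2) ^ (l - j) * walkWeight w U l j =
      ∑ x ∈ listPi (window U (l - j) (j + 1)), w x.toFinset * (1 * (pathSum w U (l - j) x -
        ((lo + hi) / 2) ^ (l - j) * pathSum w U (l - j) x.dropLast)) := by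
    rw [walkWeight_eq_sum_dropLast hw hU hln hj.le, walkWeight, Nat.add_sub_add_right,
      Finset.mul_sum, ← Finset.sum_sub_distrib]
    exact Finset.sum_congr rfl fun x _ => by ring
  have hnn : ∀ i, ∀ t ∈ listPi (window U i (j + 1)), 0 ≤ w t.toFinset := fun i =>
    weight_nonneg_of_mem_window hw hU (by omega)
  have hU0 : 0 ≤ ∑ u ∈ U 0, w {u} :=
    Finset.sum_nonneg fun u _ => hw.nonneg _ (by rw [Finset.card_singleton]; omega)
  have h2 := listNorm_pathSum_sub_le hw hU (j := j) (by omega) hlo hle h (l - j)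
  have h3 : listNorm w (window U 0 (j + 1)) (fun _ => 1) ≤ √(∑ u ∈ U 0, w {u}) := by
    refine Real.sqrt_le_sqrt ?_
    simp only [one_pow, mul_one]
    exact sum_window_le_first hw hU 0 (by omega)
  have h4 : √(∑ t ∈ listPi (window U (l - j) (j + 1)), w t.toFinset * 1 ^ 2) ≤
      √(∑ u ∈ U l, w {u}) := by
    refine Real.sqrt_le_sqrt ?_
    simp only [one_pow, mul_one]
    have := sum_window_le_last hw hU (l - j) (j := j) (by omega)
    rwa [Nat.sub_add_cancel hj.le] at this
  have hC : 0 ≤ ((l - j : ℕ) : ℝ) * (hi / 2) ^ (l - j - 1) * ((hi - lo) / 2) :=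
    mul_nonneg (by positivity) (by linarith)
  rw [h1, Real.sqrt_mul hU0]
  refine (abs_sum_mul_le _ (hnn _) (fun _ => 1) _).trans ?_
  calc _ ≤ √(∑ u ∈ U l, w {u}) * (((l - j : ℕ) : ℝ) * (hi / 2) ^ (l - j - 1) *
        ((hi - lo) / 2) * √(∑ u ∈ U 0, w {u})) :=
        mul_le_mul h4 (h2.trans (mul_le_mul_of_nonneg_left h3 hC)) (Real.sqrt_nonneg _)
          (Real.sqrt_nonneg _)
    _ = _ := by ring

end WalkWeights

/-! ### Telescoping of approximate recursions. -/

section Telescoping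

theorem abs_sub_prod_mul_le {x ρ e : ℕ → ℝ} {S : ℝ} {l : ℕ} (hρ : ∀ j < l, 0 ≤ ρ j)
    (h : ∀ j < l, |x (j + 1) - ρ j * x j| ≤ e j * S) :
    |x l - (∏ j ∈ Finset.range l, ρ j) * x 0| ≤
      (∑ i ∈ Finset.range l, e i * ∏ j ∈ Finset.Ioo i l, ρ j) * S := by
  induction l with
  | zero => simp
  | succ l ih =>
    have ih := ih (fun j hj => hρ j (by omega)) fun j hj => h j (by omega)
    have h1 := h l (by omega)
    have hl := hρ l (by omega)
    have h2 : ∑ i ∈ Finset.range (l + 1), e i * ∏ j ∈ Finset.Ioo i (l + 1), ρ j =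
        ρ l * ∑ i ∈ Finset.range l, e i * ∏ j ∈ Finset.Ioo i l, ρ j + e l := by
      rw [Finset.sum_range_succ, Finset.mul_sum]
      congr 1
      · refine Finset.sum_congr rfl fun i hi => ?_
        have hi := Finset.mem_range.1 hi
        have : Finset.Ioo i (l + 1) = insert l (Finset.Ioo i l) := by
          ext a
          simp only [Finset.mem_Ioo, Finset.mem_insert]
          omega
        rw [this, Finset.prod_insert (by simp)]
        ring
      · have : Finset.Ioo l (l + 1) = ∅ := by
          ext a
          simp only [Finset.mem_Ioo, Finset.notMem_empty, iff_false]
          omega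
        rw [this, Finset.prod_empty, mul_one]
    have h3 : x (l + 1) - (∏ j ∈ Finset.range (l + 1), ρ j) * x 0 =
        (x (l + 1) - ρ l * x l) + ρ l * (x l - (∏ j ∈ Finset.range l, ρ j) * x 0) := by
      rw [Finset.prod_range_succ]
      ring
    rw [h2, h3]
    refine (abs_add_le _ _).trans ?_
    rw [abs_mul, abs_of_nonneg hl]
    have h4 := mul_le_mul_of_nonneg_left ih hl
    linarith

end Telescoping

/-! ### The mixing estimates. -/

section Mixing

variable {V : Type*} [Fintype V] [DecidableEq V] {X : PreAbstractSimplicialComplex V}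
  {m : Finset V → ℝ} {n l : ℕ}

/-- A family of sets of vertices indexed by `Fin (l + 1)`, extended by empty sets. -/
def extendColours (U : Fin (l + 1) → Finset V) (i : ℕ) : Finset V :=
  if h : i < l + 1 then U ⟨i, h⟩ else ∅

omit [Fintype V] [DecidableEq V] in
theorem extendColours_val (U : Fin (l + 1) → Finset V) (i : Fin (l + 1)) :
    extendColours U i = U i :=
  dif_pos i.2

omit [Fintype V] [DecidableEq V] in
theorem disjoint_extendColours {U : Fin (l + 1) → Finset V}
    (hU : ∀ i j, i ≠ j → Disjoint (U i) (U j)) (i j : ℕ) (hij : i ≠ j) :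
    Disjoint (extendColours U i) (extendColours U j) := by
  unfold extendColours
  split_ifs
  · exact hU _ _ (by simpa using hij)
  all_goals simp

omit [Fintype V] in
theorem mem_listPi_window_iff {U : Fin (l + 1) → Finset V} {t : List V} :
    t ∈ listPi (window (extendColours U) 0 (l + 1)) ↔
      ∃ u : Fin (l + 1) → V, (∀ i, u i ∈ U i) ∧ t = List.ofFn u := by
  rw [mem_listPi, List.forall₂_iff_get]
  simp only [window, List.length_map, List.length_range', List.get_eq_getElem, List.getElem_map,
    List.getElem_range', zero_add, one_mul]
  constructor
  · rintro ⟨hlen, h⟩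
    refine ⟨fun i => t[i.1]'(by omega), fun i => ?_, ?_⟩
    · rw [← extendColours_val U]
      exact h i.1 (by omega) i.2
    · refine List.ext_getElem (by simp [hlen]) fun i h1 h2 => ?_
      rw [List.getElem_ofFn]
  · rintro ⟨u, hu, rfl⟩
    refine ⟨by simp, fun i h1 h2 => ?_⟩
    rw [List.getElem_ofFn]
    have := hu ⟨i, h2⟩
    rwa [← extendColours_val U] at this

omit [Fintype V] in
theorem toFinset_ofFn (u : Fin (l + 1) → V) :
    (List.ofFn u).toFinset = Finset.univ.image u := by
  ext x
  rw [List.mem_toFinset, List.mem_ofFn]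
  simp

/-- By disjointness a simplex meeting all colours comes from exactly one list, and lists that span
no simplex have weight zero. -/
theorem mixedWeight_eq_sum_listPi {U : Fin (l + 1) → Finset V}
    (hU : ∀ i j, i ≠ j → Disjoint (U i) (U j)) :
    mixedWeight X m U =
      ∑ t ∈ listPi (window (extendColours U) 0 (l + 1)), cellWeight X m t.toFinset := by
  classical
  have hne : ∀ u : Fin (l + 1) → V, Finset.univ.image u ≠ ∅ := fun u =>
    (Finset.univ_nonempty.image u).ne_empty
  symm
  unfold mixedWeight
  rw [← Finset.sum_filter_of_ne (p := fun t => t.toFinset ∈ X)]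
  · refine Finset.sum_bij (fun t _ => t.toFinset) ?_ ?_ ?_ ?_
    · intro t ht
      obtain ⟨ht, htX⟩ := Finset.mem_filter.1 ht
      refine Finset.mem_filter.2 ⟨mem_cells.2
        ⟨card_of_mem_window (disjoint_extendColours hU) ht, Or.inr htX⟩, ?_⟩
      obtain ⟨u, hu, rfl⟩ := mem_listPi_window_iff.1 ht
      exact ⟨u, hu, toFinset_ofFn u⟩
    · intro s hs t ht hst
      obtain ⟨u, hu, rfl⟩ := mem_listPi_window_iff.1 (Finset.mem_filter.1 hs).1
      obtain ⟨v, hv, rfl⟩ := mem_listPi_window_iff.1 (Finset.mem_filter.1 ht).1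
      congr 1
      funext i
      have h1 : u i ∈ (List.ofFn v).toFinset := by
        rw [← hst, toFinset_ofFn]
        exact Finset.mem_image_of_mem u (Finset.mem_univ i)
      rw [toFinset_ofFn, Finset.mem_image] at h1
      obtain ⟨k, -, hk⟩ := h1
      by_cases hik : i = k
      · rw [← hk, hik]
      · exact absurd (hk ▸ hv k) (Finset.disjoint_left.1 (hU i k hik) (hu i))
    · intro s hs
      obtain ⟨h1, u, hu, rfl⟩ := Finset.mem_filter.1 hs
      refine ⟨List.ofFn u, Finset.mem_filter.2 ⟨mem_listPi_window_iff.2 ⟨u, hu, rfl⟩, ?_⟩,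
        toFinset_ofFn u⟩
      rw [toFinset_ofFn]
      exact (mem_cells.1 h1).2.resolve_left (hne u)
    · intro t ht
      exact if_pos (Or.inr (Finset.mem_filter.1 ht).2)
  · intro t ht h0
    obtain ⟨u, hu, rfl⟩ := mem_listPi_window_iff.1 ht
    by_contra hX
    refine h0 (if_neg ?_)
    rw [toFinset_ofFn] at hX ⊢
    exact not_or_intro (hne u) hX

theorem vertexWeight_eq_sum {U : Finset V} (hU : U ⊆ verts X) :
    vertexWeight m U = ∑ u ∈ U, cellWeight X m {u} :=
  Finset.sum_congr rfl fun _ hu => (if_pos (Or.inr (mem_verts.1 (hU hu)))).symm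

theorem vertexWeight_pos (hm : IsWeight X n m) {U : Finset V} (hne : U.Nonempty)
    (hU : U ⊆ verts X) : 0 < vertexWeight m U :=
  Finset.sum_pos (fun u hu => hm.1 1 (by omega) _ (mem_cells.2 ⟨Finset.card_singleton u,
    Or.inr (mem_verts.1 (hU hu))⟩)) hne

theorem vertexWeight_verts (hm : IsWeight X n m) :
    vertexWeight m (verts X) = cellWeight X m ∅ := by
  rw [← (isBalanced_cellWeight hm).sum_eq ∅ (by simp), vertexWeight_eq_sum subset_rfl]
  have h : ∀ u, linkVertex (cellWeight X m) ∅ u = cellWeight X m {u} := fun u => by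
    simp [linkVertex]
  simp only [h]
  refine Finset.sum_subset (Finset.subset_univ _) fun u _ hu => if_neg ?_
  simpa using fun h => hu (mem_verts.2 h)

theorem rCoef_pos {lam kap : ℝ} (hlow : ((n : ℝ) - 1) / n < lam) (hle : lam ≤ kap) {j : ℕ}
    (hj : j < n) : 0 < rCoef n j (lam, kap) :=
  div_pos (add_pos (level_pos hj hlow) (level_pos hj (hlow.trans_le hle))) two_pos

/-- The base of the power is positive because κ_j > j / (j + 1), which is the threshold that descent
preserves. -/
theorem epsCoef_nonneg {lam kap : ℝ} (hlow : ((n : ℝ) - 1) / n < lam) (hle : lam ≤ kap) {j : ℕ}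
    (hj : j < n) (hjl : j < l) : 0 ≤ epsCoef n l j (lam, kap) := by
  have h1 := level_le_level hj hlow hle
  have h2 := lt_level hj (hlow.trans_le hle)
  rw [div_lt_iff₀ (by positivity)] at h2
  have h3 : (j : ℝ) < l := by exact_mod_cast hjl
  refine mul_nonneg (mul_nonneg (mul_nonneg ?_ ?_) (pow_nonneg ?_ _)) ?_
  · linarith
  · positivity
  · simp only
    linarith
  · simp only
    linarith

theorem errorCoef_nonneg {lam kap : ℝ} (hlow : ((n : ℝ) - 1) / n < lam) (hle : lam ≤ kap)
    (hln : l ≤ n) : 0 ≤ errorCoef n l (lam, kap) :=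
  Finset.sum_nonneg fun i hi => by
    have hi := Finset.mem_range.1 hi
    exact mul_nonneg (epsCoef_nonneg hlow hle (hi.trans_le hln) hi)
      (Finset.prod_nonneg fun j hj =>
        pow_nonneg (rCoef_pos hlow hle ((Finset.mem_Ioo.1 hj).2.trans_le hln)).le _)

/-- The mixing estimate for the first and the last of the sets. -/
theorem abs_mixedWeight_sub_le (hln : l ≤ n) (hX : IsPure X n) (hm : IsWeight X n m)
    {lam kap : ℝ} (h : TwoSidedLocalSpectralExpansion X m n lam kap) {U : Fin (l + 1) → Finset V}
    (hUX : ∀ i, U i ⊆ verts X) (hU : ∀ i j, i ≠ j → Disjoint (U i) (U j)) :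
    |mixedWeight X m U - mainCoef n l (lam, kap) *
        ((∏ i, vertexWeight m (U i)) / vertexWeight m (verts X) ^ l)| ≤
      errorCoef n l (lam, kap) * √(vertexWeight m (U 0) * vertexWeight m (U (Fin.last l))) := by
  have hw := isBalanced_cellWeight hm
  have hU' := disjoint_extendColours hU
  have hlow := h.lower
  have hval : ∀ i : Fin (l + 1), ∑ u ∈ extendColours U i, cellWeight X m {u} =
      vertexWeight m (U i) := fun i => by
    rw [extendColours_val, vertexWeight_eq_sum (hUX i)]
  have h0 : cellWeight X m ∅ ≠ 0 :=
    (cellWeight_pos hm (c := 0) (by omega) (mem_cells.2 ⟨rfl, Or.inl rfl⟩)).ne'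
  have hstart : walkWeight (cellWeight X m) (extendColours U) l 0 =
      (∏ i, vertexWeight m (U i)) / vertexWeight m (verts X) ^ l := by
    rw [walkWeight_zero _ _ _ h0, vertexWeight_verts hm, Finset.prod_range]
    simp only [hval]
  have hend : walkWeight (cellWeight X m) (extendColours U) l l = mixedWeight X m U := by
    rw [walkWeight_self hw hU' hln, mixedWeight_eq_sum_listPi hU]
  rw [← hstart, ← hend]
  refine abs_sub_prod_mul_le (fun j hj => pow_nonneg (rCoef_pos hlow h.le (by omega)).le _)
    fun j hj => ?_
  have hjn : j < n := by omega
  have h1 := level_le_level hjn hlow h.le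
  have hk := one_le_level hX hm h hjn
  have key := abs_walkWeight_sub_le hw hU' hln hj (level_pos hjn hlow).le h1
    fun τ hτ => linkBounds_level hm h hjn hτ
  have hfirst := hval 0
  have hlast := hval (Fin.last l)
  rw [Fin.val_zero] at hfirst
  rw [Fin.val_last] at hlast
  rw [hfirst, hlast] at key
  refine key.trans (mul_le_mul_of_nonneg_right ?_ (Real.sqrt_nonneg _))
  rw [Nat.cast_sub hj.le]
  have hj' : (j : ℝ) ≤ l := by exact_mod_cast hj.le
  have hj0 : (0 : ℝ) ≤ j := Nat.cast_nonneg j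
  -- The walk estimate gives (l - j) (κ_j / 2)^(l-j-1) (κ_j - λ_j) / 2. This is at most ε_j, since
  -- κ_j ≥ 1 implies κ_j ≤ (j + 1) κ_j - j, and j + 1 ≥ 1.
  refine mul_le_mul_of_nonneg_right (mul_le_mul ?_ (pow_le_pow_left₀ ?_ ?_ _) ?_ ?_) ?_
  · nlinarith
  · linarith
  · simp only
    nlinarith
  · exact pow_nonneg (by linarith) _
  · exact mul_nonneg (by linarith) (by linarith)
  · linarith

theorem mixedWeight_comp_perm (U : Fin (l + 1) → Finset V) (σ : Equiv.Perm (Fin (l + 1))) :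
    mixedWeight X m (U ∘ σ) = mixedWeight X m U := by
  unfold mixedWeight
  congr 1
  ext s
  simp only [Finset.mem_filter, Function.comp_apply]
  refine and_congr_right fun _ => ⟨?_, ?_⟩
  · rintro ⟨u, hu, rfl⟩
    refine ⟨u ∘ σ.symm, fun i => by simpa using hu (σ.symm i), ?_⟩
    ext x
    simp only [Finset.mem_image, Finset.mem_univ, true_and, Function.comp_apply]
    exact σ.symm.surjective.exists
  · rintro ⟨u, hu, rfl⟩
    refine ⟨u ∘ σ, fun i => hu (σ i), ?_⟩
    ext x
    simp only [Finset.mem_image, Finset.mem_univ, true_and, Function.comp_apply]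
    exact σ.surjective.exists

theorem exists_perm_zero_last {i j : Fin (l + 1)} (hl : 1 ≤ l) (hij : i ≠ j) :
    ∃ σ : Equiv.Perm (Fin (l + 1)), σ 0 = i ∧ σ (Fin.last l) = j := by
  have h0 : (0 : Fin (l + 1)) ≠ Fin.last l := by
    intro h
    have := congrArg Fin.val h
    simp at this
    omega
  -- The inner swap fixes 0 because j ≠ i; it sends the last index to the preimage of j under the
  -- outer swap.
  refine ⟨Equiv.swap 0 i * Equiv.swap (Fin.last l) (Equiv.swap 0 i j), ?_, ?_⟩
  · rw [Equiv.Perm.mul_apply, Equiv.swap_apply_of_ne_of_ne h0, Equiv.swap_apply_left]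
    intro h
    apply hij
    have h1 := congrArg (Equiv.swap 0 i) h
    rwa [Equiv.swap_apply_left, Equiv.swap_apply_self] at h1
  · simp

/-- The mixing estimate for any two of the sets. -/
theorem abs_mixedWeight_sub_le_of_ne (hl : 1 ≤ l) (hln : l ≤ n) (hX : IsPure X n)
    (hm : IsWeight X n m) {lam kap : ℝ} (h : TwoSidedLocalSpectralExpansion X m n lam kap)
    {U : Fin (l + 1) → Finset V} (hUX : ∀ i, U i ⊆ verts X)
    (hU : ∀ i j, i ≠ j → Disjoint (U i) (U j)) {i j : Fin (l + 1)} (hij : i ≠ j) :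
    |mixedWeight X m U - mainCoef n l (lam, kap) *
        ((∏ i, vertexWeight m (U i)) / vertexWeight m (verts X) ^ l)| ≤
      errorCoef n l (lam, kap) * √(vertexWeight m (U i) * vertexWeight m (U j)) := by
  obtain ⟨σ, h0, h1⟩ := exists_perm_zero_last hl hij
  have key := abs_mixedWeight_sub_le hln hX hm h (U := U ∘ σ) (fun i => hUX _)
    fun a b hab => hU _ _ (σ.injective.ne hab)
  rw [mixedWeight_comp_perm] at key
  simp only [Function.comp_apply, h0, h1] at key
  rwa [Equiv.prod_comp σ fun i => vertexWeight m (U i)] at key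

/-- Bounds by geometric means of two of `l + 1` positive numbers give a bound by the geometric
mean of all of them. -/
theorem le_mul_prod_rpow {D E : ℝ} (hD : 0 ≤ D) (hE : 0 ≤ E) (hl : 1 ≤ l) {a : Fin (l + 1) → ℝ}
    (ha : ∀ i, 0 < a i) (h : ∀ i j, i ≠ j → D ≤ E * √(a i * a j)) :
    D ≤ E * (∏ i, a i) ^ (1 / ((l : ℝ) + 1)) := by
  have hP : 0 < ∏ i, a i := Finset.prod_pos fun i _ => ha i
  have hne : ∀ i : Fin (l + 1), i ≠ finRotate (l + 1) i := by
    intro i hi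
    rw [finRotate_apply] at hi
    have h1 : (1 : Fin (l + 1)) = 0 := by simpa using hi.symm
    have := congrArg Fin.val h1
    rw [Fin.val_one', Fin.val_zero, Nat.mod_eq_of_lt (by omega)] at this
    omega
  have h1 : D ^ (l + 1) ≤ E ^ (l + 1) * ∏ i, a i := by
    -- Multiply the bounds over the cyclic pairs (i, i + 1): each a_i occurs in two square roots.
    -- The pairs consist of distinct indices because l ≥ 1.
    calc D ^ (l + 1) = ∏ _i : Fin (l + 1), D := by simp
      _ ≤ ∏ i, E * √(a i * a (finRotate (l + 1) i)) :=
        Finset.prod_le_prod (fun _ _ => hD) fun i _ => h i _ (hne i)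
      _ = E ^ (l + 1) * ∏ i, (√(a i) * √(a (finRotate (l + 1) i))) := by
        rw [Finset.prod_mul_distrib]
        simp [Real.sqrt_mul (ha _).le]
      _ = E ^ (l + 1) * ∏ i, a i := by
        rw [Finset.prod_mul_distrib, Equiv.prod_comp (finRotate (l + 1)) fun i => √(a i),
          ← Finset.prod_mul_distrib]
        simp [Real.mul_self_sqrt (ha _).le]
  refine le_of_pow_le_pow_left₀ (n := l + 1) (by omega)
    (mul_nonneg hE (Real.rpow_nonneg hP.le _)) ?_
  rw [mul_pow, ← Real.rpow_natCast (_ ^ _), ← Real.rpow_mul hP.le]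
  have : 1 / ((l : ℝ) + 1) * ((l + 1 : ℕ) : ℝ) = 1 := by
    push_cast
    field_simp
  rwa [this, Real.rpow_one]

end Mixing

end LocalSpectral

-- The theorem.

universe u

open LocalSpectral in
theorem theorem2p6 (n l : ℕ) (hl : 1 ≤ l) (hln : l ≤ n) :
    ContinuousOn (mainCoef n l) (paramDomain n) ∧
    ContinuousOn (errorCoef n l) (paramDomain n) ∧
    Tendsto (mainCoef n l) (𝓝 (1, 1)) (𝓝 1) ∧
    Tendsto (errorCoef n l) (𝓝 (1, 1)) (𝓝 0) ∧
    ∀ (V : Type u) [Fintype V] [DecidableEq V] (X : PreAbstractSimplicialComplex V)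
      (m : Finset V → ℝ) (lam kap : ℝ),
      IsPure X n → IsWeight X n m → TwoSidedLocalSpectralExpansion X m n lam kap →
      ∀ U : Fin (l + 1) → Finset V,
        (∀ i, (U i).Nonempty) → (∀ i, U i ⊆ verts X) → (∀ i j, i ≠ j → Disjoint (U i) (U j)) →
        (∀ i j, i < j →
          |mixedWeight X m U - mainCoef n l (lam, kap) *
              ((∏ i, vertexWeight m (U i)) / vertexWeight m (verts X) ^ l)| ≤
            errorCoef n l (lam, kap) * √(vertexWeight m (U i) * vertexWeight m (U j))) ∧
        |mixedWeight X m U - mainCoef n l (lam, kap) *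
            ((∏ i, vertexWeight m (U i)) / vertexWeight m (verts X) ^ l)| ≤
          errorCoef n l (lam, kap) * (∏ i, vertexWeight m (U i)) ^ (1 / ((l : ℝ) + 1)) := by
  have hA := continuousOn_mainCoef hln
  have hE := continuousOn_errorCoef hln
  have hmem := paramDomain_mem_nhds (hl.trans hln)
  refine ⟨hA, hE, ?_, ?_, ?_⟩
  · simpa [ContinuousAt, mainCoef_one] using hA.continuousAt hmem
  · simpa [ContinuousAt, errorCoef_one] using hE.continuousAt hmem
  intro V _ _ X m lam kap hX hm h U hne hUX hU
  have key := fun i j (hij : i ≠ j) =>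
    abs_mixedWeight_sub_le_of_ne hl hln hX hm h hUX hU hij
  exact ⟨fun i j hij => key i j hij.ne, le_mul_prod_rpow (abs_nonneg _)
    (errorCoef_nonneg h.lower h.le hln) hl (fun i => vertexWeight_pos hm (hne i) (hUX i)) key⟩
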